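/- For a polynomial $f\in\mathbb{R}[t]$ and an angle $\beta\in\mathbb{R}$, the open polynomial half plane of $(f,\beta)$ is $$\{(x,y)\in\mathbb{R}^2 : f(\cos(\beta)x+\sin(\beta)y)-(-\sin(\beta)x+\cos(\beta)y)>0\},$$ i.e. the open region below the graph of $f$, drawn in the frame rotated by $\beta$. A side is a set of the form $$\{(x,y) : \cos(\beta)x+\sin(\beta)y\in J,\ -\sin(\beta)x+\cos(\beta)y=f(\cos(\beta)x+\sin(\beta)y)\}$$ with $f\in\mathbb{R}[t]$, $\beta\in\mathbb{R}$ and $J\subseteq\mathbb{R}$ a closed interval (possibly unbounded) with more than one point. A region of type I is a simply connected set $T\subseteq\mathbb{R}^2$ that is the closure of a nonempty connected open set and whose boundary $\partial T$ is a union of finitely many sides. A region of type II is a set of the form $T\setminus\partial T$ with $T$ a region of type I. Theorem. Let $f_1,\dots,f_k$ be real polynomials and $\beta_1,\dots,\beta_k$ angles, and let $X=\{f_1>0\}\cap\dots\cap\{f_k>0\}$ be the intersection of the open polynomial half planes of $(f_1,\beta_1),\dots,(f_k,\beta_k)$. Then there are an integer $m\ge 0$ and pairwise disjoint regions of type II $U_1,\dots,U_m$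 with $X=U_1\cup\dots\cup U_m$. -/

import Mathlib

/-- First coordinate of the point `p` in the coordinate frame rotated by the angle `θ`. -/
noncomputable def frameX (θ : ℝ) (p : ℝ × ℝ) : ℝ :=
  Real.cos θ * p.1 + Real.sin θ * p.2

/-- Second coordinate of the point `p` in the coordinate frame rotated by the angle `θ`. -/
noncomputable def frameY (θ : ℝ) (p : ℝ × ℝ) : ℝ :=
  -Real.sin θ * p.1 + Real.cos θ * p.2

/-- The open polynomial half plane `{f > 0}`: the points strictly below the graph of the
polynomial function `f`, the graph being drawn in the frame rotated by the angle `θ`. -/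
def openPolyHalfPlane (f : Polynomial ℝ) (θ : ℝ) : Set (ℝ × ℝ) :=
  {p | 0 < f.eval (frameX θ p) - frameY θ p}

/-- A side: the part of the (rotated) graph of a polynomial function that lies over a
nondegenerate closed interval, which may be bounded, a half line or the whole line. -/
def IsSide (S : Set (ℝ × ℝ)) : Prop :=
  ∃ (f : Polynomial ℝ) (θ : ℝ) (J : Set ℝ),
    IsClosed J ∧ J.OrdConnected ∧ J.Nontrivial ∧
      S = {p | frameX θ p ∈ J ∧ frameY θ p = f.eval (frameX θ p)}

/-- A closed region of the plane: the closure of a nonempty connected open set. -/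
def IsClosedRegion (T : Set (ℝ × ℝ)) : Prop :=
  ∃ D : Set (ℝ × ℝ), IsOpen D ∧ IsConnected D ∧ T = closure D

/-- A region of type I: a simply connected closed region (bounded or not) whose boundary
(connected or not) consists of finitely many sides. -/
def IsTypeI (T : Set (ℝ × ℝ)) : Prop :=
  IsClosedRegion T ∧ IsSimplyConnected T ∧
    ∃ 𝒮 : Set (Set (ℝ × ℝ)), 𝒮.Finite ∧ (∀ S ∈ 𝒮, IsSide S) ∧ frontier T = ⋃₀ 𝒮

/-- A region of type II: a region of type I without its boundary. -/
def IsTypeII (U : Set (ℝ × ℝ)) : Prop :=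
  ∃ T : Set (ℝ × ℝ), IsTypeI T ∧ U = T \ frontier T

/-! From a point where some `f i` is nonpositive, the ray pointing upwards in the frame of `β i`
never meets the closure of the region X again (`not_mem_closure_polyRegion`). Hence X is the
interior of its closure, and so is each component C. The regions of type II are the components of X,
with T = closure C.

The frontier of T lies on the curves `f i = 0`. Away from finitely many crossings, lying on this
frontier is both an open and a closed condition along a curve, and the crossings are limits of other
frontier points. So the frontier consists of whole pieces of curves between crossings
(`frontier_component_eq_sUnion`).

The same rays show that T has no holes. After a rotation into general position, vertical lines
through the crossings and the vertical tangents cut X into finitely many bands between graphs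
(`exists_bands`). By finiteness there are finitely many components, and each T is a connected finite
union of closed bands. Such a union is an absolute extensor (`isExtensor_bandUnion`), hence
contractible. The induction peels pieces off at the left end and glues extensors along intersections
that are again extensors. The one obstruction is two bands joined at the left end of their strip. A
ray from the top of the lower band then leaves to the right, and a graph between the bands continued
by this ray meets the union in a single point; cutting there leaves two unions with fewer bands. -/

open Set Filter Topology

/-! ### Absolute extensors and gluing. -/

/-- `K` is an absolute extensor for metric spaces: continuous maps from closed subsets into `K`
extend to the whole space. -/
def IsExtensor {E : Type*} [TopologicalSpace E] (K : Set E) : Prop :=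
  ∀ (Z : Type) [MetricSpace Z] (D : Set Z) (f : Z → E), IsClosed D → ContinuousOn f D →
    MapsTo f D K → ∃ g : Z → E, Continuous g ∧ (∀ z, g z ∈ K) ∧ EqOn g f D

theorem isExtensor_singleton {E : Type*} [TopologicalSpace E] (x : E) : IsExtensor {x} := by
  intro Z _ D f _ _ hm
  exact ⟨fun _ => x, continuous_const, fun _ => rfl, fun z hz => (hm hz).symm⟩

theorem isExtensor_ordConnected {t : Set ℝ} (ht : t.OrdConnected) (hne : t.Nonempty) :
    IsExtensor t := by
  intro Z _ D f hD hf hm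
  obtain ⟨g, hg, hgf⟩ := ContinuousMap.exists_restrict_eq_forall_mem_of_closed
    (⟨D.domRestrict f, hf.domRestrict⟩ : C(D, ℝ)) (t := t) (fun x => hm x.2) hne hD
  exact ⟨g, g.continuous, hg, fun z hz => congrArg (fun k : C(D, ℝ) => k ⟨z, hz⟩) hgf⟩

theorem IsExtensor.prod {E F : Type*} [TopologicalSpace E] [TopologicalSpace F] {K : Set E}
    {L : Set F} (hK : IsExtensor K) (hL : IsExtensor L) : IsExtensor (K ×ˢ L) := by
  intro Z _ D f hD hf hm
  obtain ⟨g, hg, hgK, hgf⟩ := hK Z D (fun z => (f z).1) hD hf.fst (fun z hz => (hm hz).1)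
  obtain ⟨h, hh, hhL, hhf⟩ := hL Z D (fun z => (f z).2) hD hf.snd (fun z hz => (hm hz).2)
  exact ⟨fun z => (g z, h z), hg.prodMk hh, fun z => ⟨hgK z, hhL z⟩,
    fun z hz => Prod.ext (hgf hz) (hhf hz)⟩

theorem IsExtensor.retract {E : Type*} [TopologicalSpace E] {K L : Set E} (hK : IsExtensor K)
    {r : E → E} (hr : Continuous r) (hrL : ∀ x ∈ K, r x ∈ L) (hrid : ∀ x ∈ L, r x = x)
    (hLK : L ⊆ K) : IsExtensor L := by
  intro Z _ D f hD hf hm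
  obtain ⟨g, hg, hgK, hgf⟩ := hK Z D f hD hf (fun z hz => hLK (hm hz))
  exact ⟨r ∘ g, hr.comp hg, fun z => hrL _ (hgK z), fun z hz => by
    simp only [Function.comp, hgf hz, hrid _ (hm hz)]⟩

/-- Let `DA`, `DB` be the parts of `D` mapped into `A`, `B`, and split `Z` according to which of
them is nearer. On the interface the map is first extended into `A ∩ B`. Each half is then extended
into its own set with these interface values prescribed, so the two extensions agree where they
meet. -/
theorem IsExtensor.union {E : Type*} [TopologicalSpace E] {A B : Set E} (hA : IsExtensor A)
    (hB : IsExtensor B) (hAc : IsClosed A) (hBc : IsClosed B) (hAB : IsExtensor (A ∩ B)) :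
    IsExtensor (A ∪ B) := by
  classical
  intro Z _ D f hD hf hm
  set DA := D ∩ f ⁻¹' A with hDA
  set DB := D ∩ f ⁻¹' B with hDB
  have hDAc : IsClosed DA := hf.preimage_isClosed_of_isClosed hD hAc
  have hDBc : IsClosed DB := hf.preimage_isClosed_of_isClosed hD hBc
  set ZA := {z | Metric.infEDist z DA ≤ Metric.infEDist z DB} with hZA
  set ZB := {z | Metric.infEDist z DB ≤ Metric.infEDist z DA} with hZB
  have hZAc : IsClosed ZA := isClosed_le Metric.continuous_infEDist Metric.continuous_infEDist
  have hZBc : IsClosed ZB := isClosed_le Metric.continuous_infEDist Metric.continuous_infEDist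
  have key : ∀ {P Q : Set Z} {z : Z}, IsClosed P →
      Metric.infEDist z P ≤ Metric.infEDist z Q → z ∈ Q → z ∈ P := by
    intro P Q z hP hle hz
    rw [← hP.closure_eq, Metric.mem_closure_iff_infEDist_zero]
    rw [Metric.infEDist_zero_of_mem hz] at hle
    exact le_antisymm hle zero_le
  obtain ⟨g0, hg0, hg0K, hg0f⟩ := hAB Z (DA ∩ DB) f (hDAc.inter hDBc)
    (hf.mono fun z hz => hz.1.1) (fun z hz => ⟨hz.1.2, hz.2.2⟩)
  have ext : ∀ {P : Set Z} {K : Set E}, IsExtensor K → A ∩ B ⊆ K → IsClosed P → ContinuousOn f P →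
      MapsTo f P K → P ∩ (ZA ∩ ZB) ⊆ DA ∩ DB →
      ∃ g : Z → E, Continuous g ∧ (∀ z, g z ∈ K) ∧ EqOn g f P ∧ EqOn g g0 (ZA ∩ ZB) := by
    intro P K hK hABK hP hfP hmP hsub
    set F : Z → E := fun z => if z ∈ P then f z else g0 z with hF
    have e1 : EqOn F f P := fun z hz => by simp [hF, hz]
    have e2 : EqOn F g0 (ZA ∩ ZB) := fun z hz => by
      by_cases hzP : z ∈ P
      · simp only [hF, hzP, if_true]
        exact (hg0f (hsub ⟨hzP, hz⟩)).symm
      · simp [hF, hzP]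
    have hFc : ContinuousOn F (P ∪ (ZA ∩ ZB)) :=
      (hfP.congr e1).union_of_isClosed (hg0.continuousOn.congr e2) hP (hZAc.inter hZBc)
    obtain ⟨g, hg, hgK, hgF⟩ := hK Z _ F (hP.union (hZAc.inter hZBc)) hFc (by
      rintro z (hz | hz)
      · rw [e1 hz]; exact hmP hz
      · rw [e2 hz]; exact hABK (hg0K z))
    exact ⟨g, hg, hgK, fun z hz => (hgF (Or.inl hz)).trans (e1 hz),
      fun z hz => (hgF (Or.inr hz)).trans (e2 hz)⟩
  obtain ⟨gA, hgA, hgAK, hgAf, hgA0⟩ := ext hA inter_subset_left hDAc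
    (hf.mono inter_subset_left) (fun z hz => hz.2) (fun z hz => ⟨hz.1, key hDBc hz.2.2 hz.1⟩)
  obtain ⟨gB, hgB, hgBK, hgBf, hgB0⟩ := ext hB inter_subset_right hDBc
    (hf.mono inter_subset_left) (fun z hz => hz.2) (fun z hz => ⟨key hDAc hz.2.1 hz.1, hz.1⟩)
  have htot : ∀ z, z ∉ ZA → z ∈ ZB := fun z hz => by
    simp only [hZA, hZB, mem_ofPred_eq, not_le] at hz ⊢
    exact hz.le
  set G : Z → E := fun z => if z ∈ ZA then gA z else gB z with hG
  have eA : EqOn G gA ZA := fun z hz => by simp [hG, hz]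
  have eB : EqOn G gB ZB := fun z hz => by
    by_cases hzA : z ∈ ZA
    · simp only [hG, hzA, if_true]
      exact (hgA0 ⟨hzA, hz⟩).trans (hgB0 ⟨hzA, hz⟩).symm
    · simp [hG, hzA]
  refine ⟨G, ?_, ?_, ?_⟩
  · have := (hgA.continuousOn.congr eA).union_of_isClosed (hgB.continuousOn.congr eB) hZAc hZBc
    rw [← continuousOn_univ]
    refine this.mono fun z _ => ?_
    by_cases hz : z ∈ ZA
    exacts [Or.inl hz, Or.inr (htot z hz)]
  · intro z
    by_cases hz : z ∈ ZA
    · rw [eA hz]; exact Or.inl (hgAK z)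
    · rw [eB (htot z hz)]; exact Or.inr (hgBK z)
  · intro z hz
    by_cases hzA : z ∈ ZA
    · have : z ∈ DA := by
        rcases hm hz with h | h
        · exact ⟨hz, h⟩
        · exact key hDAc hzA ⟨hz, h⟩
      rw [eA hzA, hgAf this]
    · have : z ∈ DB := by
        rcases hm hz with h | h
        · exact key hDBc (htot z hzA) ⟨hz, h⟩
        · exact ⟨hz, h⟩
      rw [eB (htot z hzA), hgBf this]

/-- Every nonempty closed extensor in a normed space is contractible, hence simply connected. -/
theorem IsExtensor.isSimplyConnected {E : Type} [NormedAddCommGroup E] [NormedSpace ℝ E]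
    {K : Set E} (hK : IsExtensor K) (hKc : IsClosed K) (hne : K.Nonempty) :
    IsSimplyConnected K := by
  obtain ⟨p, hp⟩ := hne
  have hD : IsClosed (K ×ˢ ({0, 1} : Set ℝ)) := hKc.prod (Set.toFinite _).isClosed
  -- A contraction is an extension of the identity at time 0 and the constant `p` at time 1. The
  -- affine formula is only used at these two times, where its values lie in `K`.
  obtain ⟨g, hg, hgK, hgf⟩ := hK (E × ℝ) _ (fun z => (1 - z.2) • z.1 + z.2 • p) hD
    (by fun_prop) (by
      rintro ⟨z, s⟩ ⟨hz, hs⟩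
      simp only [mem_insert_iff, mem_singleton_iff] at hs
      rcases hs with rfl | rfl
      · simpa using hz
      · simpa using hp)
  have : ContractibleSpace K := by
    rw [contractible_iff_id_nullhomotopic]
    refine ⟨⟨p, hp⟩, ⟨⟨⟨fun q => ⟨g ((q.2 : E), (q.1 : ℝ)), hgK _⟩, by fun_prop⟩, ?_, ?_⟩⟩⟩
    · intro x
      ext
      simpa using hgf (show ((x : E), (0 : ℝ)) ∈ K ×ˢ ({0, 1} : Set ℝ) from ⟨x.2, by simp⟩)
    · intro x
      ext
      simpa using hgf (show ((x : E), (1 : ℝ)) ∈ K ×ˢ ({0, 1} : Set ℝ) from ⟨x.2, by simp⟩)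
  exact SimplyConnectedSpace.ofContractible K

/-- If a connected union of two closed sets has connected intersection, each of them is
connected. -/
theorem IsPreconnected.left_of_union {E : Type*} [TopologicalSpace E] {A B : Set E}
    (hA : IsClosed A) (hB : IsClosed B) (hAB : IsPreconnected (A ∪ B))
    (hI : IsPreconnected (A ∩ B)) : IsPreconnected A := by
  have aux : ∀ u v : Set E, IsClosed u → IsClosed v → A ⊆ u ∪ v → (A ∩ u).Nonempty →
      (A ∩ v).Nonempty → A ∩ B ⊆ u → (A ∩ (u ∩ v)).Nonempty := by
    intro u v hu hv huv hAu hAv hsub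
    obtain ⟨z, -, hz, hzv⟩ := isPreconnected_closed_iff.1 hAB ((A ∩ u) ∪ B) (A ∩ v)
      ((hA.inter hu).union hB) (hA.inter hv)
      (by
        rintro x (hx | hx)
        · rcases huv hx with h | h
          · exact Or.inl (Or.inl ⟨hx, h⟩)
          · exact Or.inr ⟨hx, h⟩
        · exact Or.inl (Or.inr hx))
      (by obtain ⟨x, hx⟩ := hAu; exact ⟨x, Or.inl hx.1, Or.inl hx⟩)
      (by obtain ⟨x, hx⟩ := hAv; exact ⟨x, Or.inl hx.1, hx⟩)
    rcases hz with hz | hz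
    · exact ⟨z, hz.1, hz.2, hzv.2⟩
    · exact ⟨z, hzv.1, hsub ⟨hzv.1, hz⟩, hzv.2⟩
  rw [isPreconnected_closed_iff]
  intro u v hu hv huv hAu hAv
  by_contra hcon
  -- The connected intersection lies in one of the pieces, and adding `B` to that piece would
  -- separate `A ∪ B`.
  have hsub : A ∩ B ⊆ u ∨ A ∩ B ⊆ v := by
    by_contra hh
    rw [not_or, not_subset, not_subset] at hh
    obtain ⟨⟨x, hx, hxu⟩, ⟨y, hy, hyv⟩⟩ := hh
    obtain ⟨z, hz, hzuv⟩ := isPreconnected_closed_iff.1 hI u v hu hv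
      (inter_subset_left.trans huv) ⟨y, hy, (huv hy.1).resolve_right hyv⟩
      ⟨x, hx, (huv hx.1).resolve_left hxu⟩
    exact hcon ⟨z, hz.1, hzuv⟩
  rcases hsub with h | h
  · exact hcon (aux u v hu hv huv hAu hAv h)
  · rw [union_comm] at huv
    rw [inter_comm u v] at hcon
    exact hcon (aux v u hv hu huv hAv hAu h)

/-! ### Strips and bands. -/

/-- A region over the set `base`, bounded below by the graph of `lo` and above by the graph of
`up`, where either bound may be absent. -/
structure Band where
  base : Set ℝ
  lo : Option C(ℝ, ℝ)
  up : Option C(ℝ, ℝ)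

namespace Band

def carrier (σ : Band) : Set (ℝ × ℝ) :=
  {p | p.1 ∈ σ.base ∧ (∀ g ∈ σ.lo, g p.1 ≤ p.2) ∧ ∀ h ∈ σ.up, p.2 ≤ h p.1}

/-- Projection of the height `y` to the vertical interval of the band over `x`. -/
def clamp (σ : Band) (x y : ℝ) : ℝ :=
  σ.lo.elim (σ.up.elim y fun h => min y (h x)) fun g => max (σ.up.elim y fun h => min y (h x)) (g x)

theorem continuous_clamp (σ : Band) : Continuous fun p : ℝ × ℝ => σ.clamp p.1 p.2 := by
  unfold clamp
  cases σ.lo <;> cases σ.up <;> simp only [Option.elim] <;> fun_prop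

theorem clamp_eq {σ : Band} {p : ℝ × ℝ} (hp : p ∈ σ.carrier) : σ.clamp p.1 p.2 = p.2 := by
  obtain ⟨-, h1, h2⟩ := hp
  unfold clamp
  cases hl : σ.lo <;> cases hu : σ.up <;> simp_all

theorem clamp_mem {σ : Band} {x : ℝ} (hx : x ∈ σ.base) (hle : ∀ g ∈ σ.lo, ∀ h ∈ σ.up, g x ≤ h x)
    (y : ℝ) : (x, σ.clamp x y) ∈ σ.carrier := by
  unfold clamp carrier
  cases hl : σ.lo <;> cases hu : σ.up <;> simp_all

theorem isClosed_carrier {σ : Band} (h : IsClosed σ.base) : IsClosed σ.carrier := by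
  have h1 : ∀ o : Option C(ℝ, ℝ), IsClosed {p : ℝ × ℝ | ∀ g ∈ o, g p.1 ≤ p.2} := by
    rintro (_ | g)
    · simp
    · simpa using isClosed_le (by fun_prop : Continuous fun p : ℝ × ℝ => g p.1) continuous_snd
  have h2 : ∀ o : Option C(ℝ, ℝ), IsClosed {p : ℝ × ℝ | ∀ g ∈ o, p.2 ≤ g p.1} := by
    rintro (_ | g)
    · simp
    · simpa using isClosed_le continuous_snd (by fun_prop : Continuous fun p : ℝ × ℝ => g p.1)
  exact (h.preimage continuous_fst).inter ((h1 _).inter (h2 _))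

/-- The vertical interval of the band over `x`. -/
def fiber (σ : Band) (x : ℝ) : Set ℝ := {y | (x, y) ∈ σ.carrier}

theorem isClosed_fiber {σ : Band} (h : IsClosed σ.base) (x : ℝ) : IsClosed (σ.fiber x) :=
  (isClosed_carrier h).preimage (by fun_prop)

theorem ordConnected_fiber (σ : Band) (x : ℝ) : (σ.fiber x).OrdConnected :=
  ⟨fun _ hy _ hz _ hw => ⟨hy.1, fun g hg => (hy.2.1 g hg).trans hw.1,
    fun h hh => hw.2.trans (hz.2.2 h hh)⟩⟩

end Band

/-- `S` is a closed interval one obtains by cutting the line at points of `B`. -/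
structure IsStrip (B S : Set ℝ) : Prop where
  isClosed : IsClosed S
  ordConnected : S.OrdConnected
  nonempty : (S \ B).Nonempty
  ordConnected_diff : (S \ B).OrdConnected
  subset_closure : S ⊆ closure (S \ B)
  isOpen_diff : IsOpen (S \ B)

theorem IsStrip.bound_of_mem {B S : Set ℝ} (hS : IsStrip B S) {x : ℝ} (_ : x ∈ S) (hB : x ∈ B) :
    x ∈ lowerBounds S ∨ x ∈ upperBounds S := by
  by_contra hcon
  simp only [not_or, mem_lowerBounds, mem_upperBounds, not_forall, not_le] at hcon
  obtain ⟨⟨s, hs, hsx⟩, ⟨t, ht, hxt⟩⟩ := hcon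
  obtain ⟨s', hs'x, hs'⟩ := mem_closure_iff.1 (hS.subset_closure hs) _ isOpen_Iio hsx
  obtain ⟨t', ht'x, ht'⟩ := mem_closure_iff.1 (hS.subset_closure ht) _ isOpen_Ioi hxt
  exact (hS.ordConnected_diff.out hs' ht' ⟨le_of_lt hs'x, le_of_lt ht'x⟩).2 hB

theorem IsStrip.mem_of_lowerBound {B S : Set ℝ} (hS : IsStrip B S) {a : ℝ} (ha : a ∈ S)
    (hl : a ∈ lowerBounds S) : a ∈ B := by
  by_contra hB
  obtain ⟨x, hx, hxs⟩ := (mem_nhdsLT_iff_exists_Ioo_subset' (sub_one_lt a)).1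
    (mem_nhdsWithin_of_mem_nhds (hS.isOpen_diff.mem_nhds ⟨ha, hB⟩))
  have := hl (hxs ⟨show x < (x + a) / 2 by linarith [show x < a from hx],
    by linarith [show x < a from hx]⟩).1
  linarith [show x < a from hx]

theorem IsStrip.mem_of_upperBound {B S : Set ℝ} (hS : IsStrip B S) {a : ℝ} (ha : a ∈ S)
    (hl : a ∈ upperBounds S) : a ∈ B := by
  by_contra hB
  obtain ⟨x, hx, hxs⟩ := (mem_nhdsGT_iff_exists_Ioo_subset' (lt_add_one a)).1
    (mem_nhdsWithin_of_mem_nhds (hS.isOpen_diff.mem_nhds ⟨ha, hB⟩))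
  have := hl (hxs ⟨show a < (x + a) / 2 by linarith [show a < x from hx],
    by linarith [show a < x from hx]⟩).1
  linarith [show a < x from hx]

/-- A band over a strip whose bounds do not cross in the interior of the strip. -/
structure Band.IsOver (B : Set ℝ) (σ : Band) : Prop where
  strip : IsStrip B σ.base
  lt : ∀ g ∈ σ.lo, ∀ h ∈ σ.up, ∀ x ∈ σ.base \ B, g x < h x

/-- The points of the band strictly between its bounds and in the interior of the strip. -/
def Band.inner (B : Set ℝ) (σ : Band) : Set (ℝ × ℝ) :=
  {p | p.1 ∈ σ.base \ B ∧ (∀ g ∈ σ.lo, g p.1 < p.2) ∧ ∀ h ∈ σ.up, p.2 < h p.1}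

namespace Band.IsOver

variable {B : Set ℝ} {σ : Band}

theorem le (hσ : σ.IsOver B) {g h : C(ℝ, ℝ)} (hg : g ∈ σ.lo) (hh : h ∈ σ.up) {x : ℝ}
    (hx : x ∈ σ.base) : g x ≤ h x :=
  closure_minimal (fun y hy => (hσ.lt g hg h hh y hy).le)
    (isClosed_le g.continuous h.continuous) (hσ.strip.subset_closure hx)

theorem clamp_mem (hσ : σ.IsOver B) {x : ℝ} (hx : x ∈ σ.base) (y : ℝ) :
    (x, σ.clamp x y) ∈ σ.carrier :=
  Band.clamp_mem hx (fun _ hg _ hh => hσ.le hg hh hx) y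

theorem nonempty_fiber (hσ : σ.IsOver B) {x : ℝ} (hx : x ∈ σ.base) : (σ.fiber x).Nonempty :=
  ⟨_, hσ.clamp_mem hx 0⟩

theorem isClosed (hσ : σ.IsOver B) : IsClosed σ.carrier :=
  Band.isClosed_carrier hσ.strip.isClosed

theorem isExtensor (hσ : σ.IsOver B) : IsExtensor σ.carrier := by
  have h1 : IsExtensor (σ.base ×ˢ (univ : Set ℝ)) :=
    (isExtensor_ordConnected hσ.strip.ordConnected (hσ.strip.nonempty.mono sdiff_subset)).prod
      (isExtensor_ordConnected ordConnected_univ univ_nonempty)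
  exact h1.retract (r := fun p => (p.1, σ.clamp p.1 p.2))
    (continuous_fst.prodMk σ.continuous_clamp) (fun p hp => hσ.clamp_mem hp.1 _)
    (fun p hp => Prod.ext rfl (Band.clamp_eq hp)) (fun p hp => ⟨hp.1, trivial⟩)

/-- Serves to show that a continuous function vanishing on the band only over `B` has a constant
sign off `B`. -/
theorem isPreconnected_core (hσ : σ.IsOver B) :
    IsPreconnected {p ∈ σ.carrier | p.1 ∉ B} := by
  have : {p ∈ σ.carrier | p.1 ∉ B} =
      (fun p : ℝ × ℝ => (p.1, σ.clamp p.1 p.2)) '' ((σ.base \ B) ×ˢ univ) := by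
    ext p
    constructor
    · rintro ⟨hp, hpB⟩
      exact ⟨p, ⟨⟨hp.1, hpB⟩, trivial⟩, Prod.ext rfl (Band.clamp_eq hp)⟩
    · rintro ⟨q, ⟨hq, -⟩, rfl⟩
      exact ⟨hσ.clamp_mem hq.1 _, hq.2⟩
  rw [this]
  exact (hσ.strip.ordConnected_diff.isPreconnected.prod isPreconnected_univ).image _
    (continuous_fst.prodMk σ.continuous_clamp).continuousOn

theorem subset_closure_core (hσ : σ.IsOver B) :
    σ.carrier ⊆ closure {p ∈ σ.carrier | p.1 ∉ B} := by
  intro p hp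
  have hc : Continuous fun x : ℝ => (x, σ.clamp x p.2) :=
    continuous_id.prodMk (σ.continuous_clamp.comp (continuous_id.prodMk continuous_const))
  have := map_mem_closure hc (hσ.strip.subset_closure hp.1)
    (t := {p ∈ σ.carrier | p.1 ∉ B}) (fun x hx => ⟨hσ.clamp_mem hx.1 _, hx.2⟩)
  rwa [Band.clamp_eq hp] at this

/-- A continuous section of the interior of a band. -/
theorem exists_section (hσ : σ.IsOver B) :
    ∃ s : ℝ → ℝ, Continuous s ∧ ∀ x ∈ σ.base \ B, (x, s x) ∈ σ.inner B := by
  have hlt := hσ.lt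
  unfold Band.inner
  cases hl : σ.lo with
  | none =>
    cases hu : σ.up with
    | none => exact ⟨fun _ => 0, continuous_const, fun x hx => ⟨hx, by simp, by simp⟩⟩
    | some h => exact ⟨fun x => h x - 1, by fun_prop, fun x hx => ⟨hx, by simp, by simp⟩⟩
  | some g =>
    cases hu : σ.up with
    | none => exact ⟨fun x => g x + 1, by fun_prop, fun x hx => ⟨hx, by simp, by simp⟩⟩
    | some h =>
      refine ⟨fun x => (g x + h x) / 2, by fun_prop, fun x hx => ?_⟩
      have := hlt g hl h hu x hx
      refine ⟨hx, ?_, ?_⟩ <;> simp <;> linarith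

theorem inner_nonempty (hσ : σ.IsOver B) : (σ.inner B).Nonempty := by
  obtain ⟨s, -, hs⟩ := hσ.exists_section
  obtain ⟨c, hc⟩ := hσ.strip.nonempty
  exact ⟨_, hs c hc⟩

/-- Each point is joined vertically to a continuous section, and the section over the open strip is
connected. -/
theorem isPreconnected_inner (hσ : σ.IsOver B) : IsPreconnected (σ.inner B) := by
  obtain ⟨s, hsc, hs⟩ := hσ.exists_section
  obtain ⟨c, hc⟩ := hσ.strip.nonempty
  refine isPreconnected_of_forall (c, s c) fun p hp => ?_
  refine ⟨((fun x => (x, s x)) '' (σ.base \ B)) ∪ ({p.1} ×ˢ uIcc p.2 (s p.1)), ?_,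
    Or.inl ⟨c, hc, rfl⟩, Or.inr ⟨rfl, left_mem_uIcc⟩, ?_⟩
  · refine union_subset ?_ ?_
    · rintro _ ⟨x, hx, rfl⟩
      exact hs x hx
    · rintro q ⟨hq1, hq2⟩
      have hq1 : q.1 = p.1 := hq1
      have hsp := hs p.1 hp.1
      refine ⟨hq1 ▸ hp.1, fun g hg => ?_, fun h hh => ?_⟩
      · rw [hq1]
        exact (lt_min (hp.2.1 g hg) (hsp.2.1 g hg)).trans_le hq2.1
      · rw [hq1]
        exact hq2.2.trans_lt (max_lt (hp.2.2 h hh) (hsp.2.2 h hh))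
  · exact (hσ.strip.ordConnected_diff.isPreconnected.image _
      (continuous_id.prodMk hsc).continuousOn).union (p.1, s p.1) ⟨p.1, hp.1, rfl⟩
      ⟨rfl, right_mem_uIcc⟩ (isPreconnected_singleton.prod ordConnected_uIcc.isPreconnected)

theorem subset_closure_inner (hσ : σ.IsOver B) : σ.carrier ⊆ closure (σ.inner B) := by
  obtain ⟨s, -, hs⟩ := hσ.exists_section
  refine hσ.subset_closure_core.trans (closure_minimal ?_ isClosed_closure)
  rintro p ⟨hp, hpB⟩
  have hsp := hs p.1 ⟨hp.1, hpB⟩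
  have hc : Continuous fun e : ℝ => (p.1, p.2 + e * (s p.1 - p.2)) := by fun_prop
  have h0 : (0 : ℝ) ∈ closure (Ioc 0 1) := by
    rw [closure_Ioc (zero_ne_one)]
    exact ⟨le_rfl, zero_le_one⟩
  have := map_mem_closure hc h0 (t := σ.inner B) (fun e he => ⟨⟨hp.1, hpB⟩, fun g hg => ?_,
    fun h hh => ?_⟩)
  · simpa using this
  · have h1 := hp.2.1 g hg
    have h2 : g p.1 < s p.1 := hsp.2.1 g hg
    change g p.1 < p.2 + e * (s p.1 - p.2)
    nlinarith [mul_nonneg (sub_nonneg.2 he.2) (sub_nonneg.2 h1), mul_pos he.1 (sub_pos.2 h2)]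
  · have h1 := hp.2.2 h hh
    have h2 : s p.1 < h p.1 := hsp.2.2 h hh
    change p.2 + e * (s p.1 - p.2) < h p.1
    nlinarith [mul_nonneg (sub_nonneg.2 he.2) (sub_nonneg.2 h1), mul_pos he.1 (sub_pos.2 h2)]

end Band.IsOver

/-- A band over a strip, contained in `X`, such that from every interior point of its upper
boundary a ray leaves `X`. -/
structure IsBand (B : Set ℝ) (X : Set (ℝ × ℝ)) (σ : Band) : Prop extends σ.IsOver B where
  subset : σ.carrier ⊆ X
  escape : ∀ h ∈ σ.up, ∀ c ∈ σ.base \ B, ∃ m : ℝ,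
    (∀ t > 0, (c + t, h c + m * t) ∉ X) ∨ ∀ t > 0, (c - t, h c + m * t) ∉ X

/-- The upper bound of a band does not coincide with the lower bound of another one. -/
theorem IsBand.not_adjacent {B : Set ℝ} {X : Set (ℝ × ℝ)} {σ τ : Band} (hσ : IsBand B X σ)
    (hτ : IsBand B X τ) (hb : σ.base = τ.base) {h g : C(ℝ, ℝ)} (hh : h ∈ σ.up) (hg : g ∈ τ.lo) :
    ¬ ∀ x ∈ σ.base \ B, h x = g x := by
  intro heq
  obtain ⟨c, hc⟩ := hσ.strip.nonempty
  -- If the bounds coincided, the two bands together would cover a neighbourhood of the common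
  -- boundary point, so no path from it could leave `X` at once.
  have key : ∀ (γ : ℝ → ℝ × ℝ), Continuous γ → γ 0 = (c, h c) → ¬ ∀ t > 0, γ t ∉ X := by
    intro γ hγ h0 hX
    have hev : ∀ᶠ t in 𝓝 (0 : ℝ), (γ t).1 ∈ σ.base \ B ∧ (∀ k ∈ σ.lo, k (γ t).1 < (γ t).2) ∧
        ∀ l ∈ τ.up, (γ t).2 < l (γ t).1 := by
      refine Eventually.and ?_ (Eventually.and ?_ ?_)
      · refine hγ.fst.continuousAt.eventually (hσ.strip.isOpen_diff.mem_nhds ?_)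
        simpa [h0] using hc
      · cases hlo : σ.lo with
        | none => simp
        | some k =>
          have := hσ.lt k hlo h hh c hc
          simpa using (k.continuous.comp hγ.fst).continuousAt.eventually_lt
            hγ.snd.continuousAt (by simpa [h0])
      · cases hup : τ.up with
        | none => simp
        | some l =>
          have := hτ.lt g hg l hup c (hb ▸ hc)
          simpa using hγ.snd.continuousAt.eventually_lt
            (l.continuous.comp hγ.fst).continuousAt (by simpa [h0, heq c hc])
    obtain ⟨t, ⟨ht, htlo, htup⟩, ht0⟩ :=
      ((hev.filter_mono nhdsWithin_le_nhds).and (self_mem_nhdsWithin (s := Ioi 0))).exists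
    refine hX t ht0 ?_
    rcases le_total (γ t).2 (h (γ t).1) with h1 | h1
    · exact hσ.subset ⟨ht.1, fun k hk => (htlo k hk).le,
        fun k hk => Option.mem_unique hh hk ▸ h1⟩
    · refine hτ.subset ⟨hb ▸ ht.1, fun k hk => ?_, fun k hk => (htup k hk).le⟩
      rw [← Option.mem_unique hg hk, ← heq _ ht]
      exact h1
  obtain ⟨m, hm | hm⟩ := hσ.escape h hh c hc
  · exact key (fun t => (c + t, h c + m * t)) (by fun_prop) (by simp) hm
  · exact key (fun t => (c - t, h c + m * t)) (by fun_prop) (by simp) hm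

/-! ### Systems of bands and vertical segments. -/

/-- The band `σ` lies strictly below the band `τ` over the same strip. -/
def Band.Below (B : Set ℝ) (σ τ : Band) : Prop :=
  σ.base = τ.base ∧ ∃ h ∈ σ.up, ∃ g ∈ τ.lo, ∀ x ∈ σ.base \ B, h x < g x

/-- A family of bands over non-overlapping strips which are vertically separated if their strips
agree. -/
structure IsBandSystem (B : Set ℝ) (X : Set (ℝ × ℝ)) (𝒟 : Set Band) : Prop where
  isBand : ∀ σ ∈ 𝒟, IsBand B X σ
  pairwise : ∀ σ ∈ 𝒟, ∀ τ ∈ 𝒟, σ ≠ τ →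
    ((∀ x ∈ σ.base \ B, x ∉ τ.base) ∧ ∀ x ∈ τ.base \ B, x ∉ σ.base) ∨
      σ.Below B τ ∨ τ.Below B σ

theorem IsBandSystem.mono {B : Set ℝ} {X : Set (ℝ × ℝ)} {𝒟 ℰ : Set Band}
    (h : IsBandSystem B X 𝒟) (hs : ℰ ⊆ 𝒟) : IsBandSystem B X ℰ :=
  ⟨fun σ hσ => h.isBand σ (hs hσ), fun σ hσ τ hτ => h.pairwise σ (hs hσ) τ (hs hτ)⟩

/-- A family of vertical closed segments, given by abscissa and set of heights. -/
def IsSegmentSystem (B : Set ℝ) (X : Set (ℝ × ℝ)) (𝒱 : Set (ℝ × Set ℝ)) : Prop :=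
  ∀ v ∈ 𝒱, v.1 ∈ B ∧ IsClosed v.2 ∧ v.2.OrdConnected ∧ {v.1} ×ˢ v.2 ⊆ X

/-- The union of a family of bands and a family of vertical segments. -/
def bandUnion (𝒟 : Set Band) (𝒱 : Set (ℝ × Set ℝ)) : Set (ℝ × ℝ) :=
  (⋃ σ ∈ 𝒟, σ.carrier) ∪ ⋃ v ∈ 𝒱, {v.1} ×ˢ v.2

theorem mem_bandUnion {𝒟 : Set Band} {𝒱 : Set (ℝ × Set ℝ)} {p : ℝ × ℝ} :
    p ∈ bandUnion 𝒟 𝒱 ↔ (∃ σ ∈ 𝒟, p ∈ σ.carrier) ∨ ∃ v ∈ 𝒱, p.1 = v.1 ∧ p.2 ∈ v.2 := by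
  simp [bandUnion]

theorem isClosed_bandUnion {B : Set ℝ} {X : Set (ℝ × ℝ)} {𝒟 : Set Band} {𝒱 : Set (ℝ × Set ℝ)}
    (h𝒟 : IsBandSystem B X 𝒟) (h𝒱 : IsSegmentSystem B X 𝒱) (hf : 𝒟.Finite) (hf' : 𝒱.Finite) :
    IsClosed (bandUnion 𝒟 𝒱) :=
  (hf.isClosed_biUnion fun σ hσ => (h𝒟.isBand σ hσ).isClosed).union
    (hf'.isClosed_biUnion fun v hv => isClosed_singleton.prod (h𝒱 v hv).2.1)

theorem bandUnion_subset {B : Set ℝ} {X : Set (ℝ × ℝ)} {𝒟 : Set Band} {𝒱 : Set (ℝ × Set ℝ)}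
    (h𝒟 : IsBandSystem B X 𝒟) (h𝒱 : IsSegmentSystem B X 𝒱) : bandUnion 𝒟 𝒱 ⊆ X :=
  union_subset (iUnion₂_subset fun σ hσ => (h𝒟.isBand σ hσ).subset)
    (iUnion₂_subset fun v hv => (h𝒱 v hv).2.2.2)

/-! ### Separating two bands joined at their left end. -/

section SeparatingGraph

variable {B : Set ℝ} {X : Set (ℝ × ℝ)}

theorem exists_eq_of_sub_neg_pos {a c : ℝ} (hac : a ≤ c) {u v : ℝ → ℝ} (hu : Continuous u)
    (hv : Continuous v) (ha : u a < v a) (hc : v c < u c) : ∃ x, a < x ∧ x < c ∧ u x = v x := by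
  obtain ⟨x, hx, hx0⟩ := intermediate_value_Icc hac (hu.sub hv).continuousOn
    (show (0 : ℝ) ∈ Icc ((u - v) a) ((u - v) c) from ⟨by simp; linarith, by simp; linarith⟩)
  have hx0 : u x = v x := sub_eq_zero.1 hx0
  refine ⟨x, lt_of_le_of_ne hx.1 ?_, lt_of_le_of_ne hx.2 ?_, hx0⟩
  · rintro rfl; linarith
  · rintro rfl; linarith

/-- If a lower band and an upper band are joined by a vertical segment at the left end of their
strip, a ray leaving the top of the lower band does not go to the left. -/
theorem not_escape_left {σ τ : Band} (hσ : IsBand B X σ) (hτ : IsBand B X τ)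
    (hb : σ.base = τ.base) {h g : C(ℝ, ℝ)} (hh : h ∈ σ.up) (hg : g ∈ τ.lo)
    (hlt : ∀ x ∈ σ.base \ B, h x < g x) {a : ℝ} (ha : a ∈ σ.base)
    (hseg : ∀ y ∈ Icc (h a) (g a), (a, y) ∈ X) {c : ℝ} (hc : c ∈ σ.base \ B) (hac : a < c) (m : ℝ) :
    ¬ ∀ t > 0, (c - t, h c + m * t) ∉ X := by
  intro hray
  have hr : ∀ x < c, (x, h c + m * (c - x)) ∉ X := fun x hx => by
    have := hray (c - x) (by linarith)
    rwa [sub_sub_cancel] at this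
  have hρ : Continuous fun x : ℝ => h c + m * (c - x) := by fun_prop
  have hmem : ∀ x, a < x → x < c → x ∈ σ.base := fun x h1 h2 =>
    hσ.strip.ordConnected.out ha hc.1 ⟨h1.le, h2.le⟩
  -- Compare the height of the ray over `a` with the joining segment. Above it, the ray has crossed
  -- the bottom of `τ`; on it, the ray hits the segment; below it, the ray either has crossed the
  -- bottom of `σ` or lies in `σ` over `a`. All of these are points of `X`.
  rcases lt_or_ge (g a) (h c + m * (c - a)) with h1 | h1
  · obtain ⟨x, hax, hxc, hx⟩ := exists_eq_of_sub_neg_pos hac.le g.continuous hρ h1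
      (by simpa using hlt c hc)
    refine hr x hxc (hτ.subset ⟨hb ▸ hmem x hax hxc, fun g' hg' => ?_, fun h' hh' => ?_⟩)
    · obtain rfl := Option.mem_unique hg hg'
      exact hx.le
    · exact hx ▸ hτ.le hg hh' (hb ▸ hmem x hax hxc)
  rcases le_or_gt (h a) (h c + m * (c - a)) with h2 | h2
  · exact hr a hac (hseg _ ⟨h2, h1⟩)
  · by_cases h3 : ∃ g' ∈ σ.lo, h c + m * (c - a) < g' a
    · obtain ⟨g', hg', h3⟩ := h3
      obtain ⟨x, hax, hxc, hx⟩ := exists_eq_of_sub_neg_pos hac.le hρ g'.continuous h3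
        (by simpa using hσ.lt g' hg' h hh c hc)
      refine hr x hxc (hσ.subset ⟨hmem x hax hxc, fun k hk => ?_, fun h' hh' => ?_⟩)
      · obtain rfl := Option.mem_unique hg' hk
        exact hx.ge
      · exact hx.le.trans (hσ.le hg' hh' (hmem x hax hxc))
    · push Not at h3
      refine hr a hac (hσ.subset ⟨ha, fun g' hg' => h3 g' hg', fun h' hh' => ?_⟩)
      obtain rfl := Option.mem_unique hh hh'
      exact h2.le

/-- Two bands joined by a vertical segment at the left end of their strip are separated by a
graph which passes between them and then follows a ray outside `X`. -/
theorem exists_graph_between {σ τ : Band} (hσ : IsBand B X σ) (hτ : IsBand B X τ)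
    (hb : σ.base = τ.base) {h g : C(ℝ, ℝ)} (hh : h ∈ σ.up) (hg : g ∈ τ.lo)
    (hlt : ∀ x ∈ σ.base \ B, h x < g x) {a : ℝ} (ha : a ∈ σ.base) (hl : a ∈ lowerBounds σ.base)
    (hseg : ∀ y ∈ Icc (h a) (g a), (a, y) ∈ X) :
    ∃ φ : ℝ → ℝ, Continuous φ ∧ φ a ∈ Icc (h a) (g a) ∧ ∃ c ∈ σ.base \ B,
      (∀ x, a < x → x ≤ c → h x < φ x ∧ φ x < g x) ∧ ∀ x > c, (x, φ x) ∉ X := by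
  obtain ⟨c, hc⟩ := hσ.strip.nonempty
  have haB := hσ.strip.mem_of_lowerBound ha hl
  have hac : ∀ {x}, x ∈ σ.base \ B → a < x := fun {x} hx =>
    lt_of_le_of_ne (hl hx.1) (by rintro rfl; exact hx.2 haB)
  obtain ⟨m, hm | hm⟩ := hσ.escape h hh c hc
  swap
  · exact (not_escape_left hσ hτ hb hh hg hlt ha hseg hc (hac hc) m hm).elim
  set ρ : ℝ → ℝ := fun x => h c + m * (x - c) with hρ
  have hρc : Continuous ρ := by fun_prop
  have hρ0 : ρ c = h c := by simp [hρ]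
  have hr : ∀ x > c, (x, ρ x) ∉ X := fun x hx => by
    have := hm (x - c) (by linarith)
    rwa [add_sub_cancel] at this
  -- Just to the right of `c` the ray is still above the bottom of `σ` and below `g`. Being outside
  -- `X`, it must then be strictly above `h`.
  have hev : ∀ᶠ x in 𝓝 c, x ∈ σ.base \ B ∧ (∀ k ∈ σ.lo, k x < ρ x) ∧ ρ x < g x := by
    refine Eventually.and (hσ.strip.isOpen_diff.mem_nhds hc) (Eventually.and ?_ ?_)
    · cases hlo : σ.lo with
      | none => simp
      | some k =>
        have := hσ.lt k hlo h hh c hc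
        simpa using k.continuous.continuousAt.eventually_lt hρc.continuousAt (by rwa [hρ0])
    · exact hρc.continuousAt.eventually_lt g.continuous.continuousAt (by
        rw [hρ0]; exact hlt c hc)
  obtain ⟨d, ⟨hd, hdlo, hdg⟩, hcd⟩ :=
    ((hev.filter_mono nhdsWithin_le_nhds).and (self_mem_nhdsWithin (s := Ioi c))).exists
  have hcd : c < d := hcd
  have hdh : h d < ρ d := by
    by_contra hcon
    refine hr d hcd (hσ.subset ⟨hd.1, fun k hk => (hdlo k hk).le, fun k hk => ?_⟩)
    obtain rfl := Option.mem_unique hh hk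
    exact not_lt.1 hcon
  have hgd : 0 < g d - h d := by linarith
  -- The ratio for which the interpolation between `h` and `g` meets the ray at `d`, making the
  -- glued graph continuous.
  set l : ℝ := (ρ d - h d) / (g d - h d) with hl'
  have hl0 : 0 < l := div_pos (by linarith) hgd
  have hl1 : l < 1 := (div_lt_one hgd).2 (by linarith)
  have hld : h d + l * (g d - h d) = ρ d := by
    rw [hl', div_mul_cancel₀ _ hgd.ne']; ring
  have hmid : ∀ x, h x ≤ g x → h x + l * (g x - h x) ∈ Icc (h x) (g x) := fun x hx =>
    ⟨by nlinarith, by nlinarith⟩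
  have hle : h a ≤ g a :=
    closure_minimal (fun y hy => (hlt y hy).le) (isClosed_le h.continuous g.continuous)
      (hσ.strip.subset_closure ha)
  refine ⟨fun x => if x ≤ d then h x + l * (g x - h x) else ρ x, ?_, ?_, d, hd, ?_, ?_⟩
  · refine Continuous.if_le (by fun_prop) hρc continuous_id continuous_const ?_
    rintro x rfl
    exact hld
  · simp only [(hac hd).le, if_true]
    exact hmid a hle
  · intro x hax hxd
    have hx : x ∈ σ.base \ B := by
      have hxb := hσ.strip.ordConnected.out ha hd.1 ⟨hax.le, hxd⟩
      refine ⟨hxb, fun hxB => ?_⟩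
      rcases hσ.strip.bound_of_mem hxb hxB with h1 | h1
      · exact (h1 ha).not_gt hax
      · exact hd.2 (le_antisymm hxd (h1 hd.1) ▸ hxB)
    have := hlt x hx
    simp only [hxd, if_true]
    constructor <;> nlinarith
  · intro x hx
    simp only [not_le.2 hx, if_false]
    exact hr x (hcd.trans hx)

/-- Among the bands above `σ` there is a lowest one. -/
theorem exists_nearest_above {𝒟 : Set Band} (h𝒟 : IsBandSystem B X 𝒟) (hf : 𝒟.Finite) {σ τ : Band}
    (hσ : σ ∈ 𝒟) (hτ : τ ∈ 𝒟) (hστ : σ.Below B τ) :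
    ∃ υ ∈ 𝒟, σ.Below B υ ∧ ∀ κ ∈ 𝒟, σ.Below B κ → κ = υ ∨ υ.Below B κ := by
  obtain ⟨c, hc⟩ := (h𝒟.isBand σ hσ).strip.nonempty
  -- Bands over one strip keep their vertical order, so comparing lower bounds at a single `c`
  -- suffices. The default 0 plays no role, as a band above `σ` has a lower bound.
  obtain ⟨υ, ⟨hυ, hσυ⟩, hmin⟩ := Set.exists_min_image {κ ∈ 𝒟 | σ.Below B κ}
    (fun κ => κ.lo.elim 0 fun g => g c) (hf.subset (sep_subset _ _)) ⟨τ, hτ, hστ⟩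
  refine ⟨υ, hυ, hσυ, fun κ hκ hσκ => ?_⟩
  by_contra! hcon
  have hcυ : c ∈ υ.base \ B := hσυ.1 ▸ hc
  have hcκ : c ∈ κ.base \ B := hσκ.1 ▸ hc
  rcases h𝒟.pairwise κ hκ υ hυ hcon.1 with h | h | h
  · exact h.1 c hcκ hcυ.1
  · obtain ⟨-, k, hk, l, hl, hkl⟩ := h
    obtain ⟨-, -, -, j, hj, -⟩ := id hσκ
    have h1 := hmin κ ⟨hκ, hσκ⟩
    rw [Option.mem_def.1 hj, Option.mem_def.1 hl] at h1
    have h2 := (h𝒟.isBand κ hκ).lt j hj k hk c hcκ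
    have h3 := hkl c hcκ
    simp only [Option.elim] at h1
    linarith
  · exact hcon.2 h

/-- A curve meeting a union of bands and segments in a single point cuts off a union of fewer
bands and segments. -/
theorem isExtensor_half {𝒟 : Finset Band} {𝒱 : Finset (ℝ × Set ℝ)}
    (ih : ∀ (𝒟' : Finset Band) (𝒱' : Finset (ℝ × Set ℝ)), 𝒟'.card < 𝒟.card →
      IsBandSystem B X 𝒟' → IsSegmentSystem B X 𝒱' → IsConnected (bandUnion 𝒟' 𝒱') →
      IsExtensor (bandUnion 𝒟' 𝒱'))
    (h𝒟 : IsBandSystem B X 𝒟) (h𝒱 : IsSegmentSystem B X 𝒱) {ψ : ℝ × ℝ → ℝ} (hψ : Continuous ψ)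
    (hord : ∀ x, {y | 0 ≤ ψ (x, y)}.OrdConnected) {z : ℝ × ℝ} (hzT : z ∈ bandUnion 𝒟 𝒱)
    (hzB : z.1 ∈ B) (hz0 : ψ z = 0) (hz : ∀ p ∈ bandUnion 𝒟 𝒱, ψ p = 0 → p = z)
    {κ : Band} (hκ : κ ∈ 𝒟) {q : ℝ × ℝ} (hq : q ∈ κ.carrier) (hqB : q.1 ∉ B) (hqψ : ψ q < 0)
    (hconn : IsConnected (bandUnion 𝒟 𝒱 ∩ {p | 0 ≤ ψ p})) :
    IsExtensor (bandUnion 𝒟 𝒱 ∩ {p | 0 ≤ ψ p}) := by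
  classical
  -- The zero set of `ψ` meets the union only over `B`, so no band is cut through.
  have hsign : ∀ σ ∈ 𝒟, (∀ p ∈ σ.carrier, p.1 ∉ B → 0 < ψ p) ∨
      ∀ p ∈ σ.carrier, p.1 ∉ B → ψ p < 0 := by
    intro σ hσ
    by_contra! hcon
    obtain ⟨⟨p, hp, hpB, hp0⟩, ⟨r, hr, hrB, hr0⟩⟩ := hcon
    obtain ⟨s, hs, hs0⟩ := (h𝒟.isBand σ hσ).isPreconnected_core.intermediate_value
      ⟨hp, hpB⟩ ⟨hr, hrB⟩ hψ.continuousOn ⟨hp0, hr0⟩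
    exact hs.2 (hz s (mem_bandUnion.2 (Or.inl ⟨σ, hσ, hs.1⟩)) hs0 ▸ hzB)
  set 𝒟' : Finset Band := 𝒟.filter fun σ => ∀ p ∈ σ.carrier, p.1 ∉ B → 0 < ψ p with h𝒟'
  -- The degenerate segment at `z` accounts for discarded bands that touch the curve there.
  set 𝒱' : Finset (ℝ × Set ℝ) :=
    insert (z.1, {z.2}) (𝒱.image fun v => (v.1, v.2 ∩ {y | 0 ≤ ψ (v.1, y)})) with h𝒱'
  have hsub : 𝒟' ⊆ 𝒟 := Finset.filter_subset _ _
  have hcard : 𝒟'.card < 𝒟.card := by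
    refine Finset.card_lt_card ⟨hsub, fun h => ?_⟩
    exact lt_asymm hqψ ((Finset.mem_filter.1 (h hκ)).2 q hq hqB)
  have heq : bandUnion 𝒟 𝒱 ∩ {p | 0 ≤ ψ p} = bandUnion 𝒟' 𝒱' := by
    ext p
    constructor
    · rintro ⟨hp, hp0⟩
      rcases mem_bandUnion.1 hp with ⟨σ, hσ, hpσ⟩ | ⟨v, hv, hpv1, hpv2⟩
      · rcases hsign σ hσ with h | h
        · exact mem_bandUnion.2 (Or.inl ⟨σ, Finset.mem_filter.2 ⟨hσ, h⟩, hpσ⟩)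
        · have : ψ p ≤ 0 := closure_minimal (fun r hr => (h r hr.1 hr.2).le)
            (isClosed_le hψ continuous_const) ((h𝒟.isBand σ hσ).subset_closure_core hpσ)
          obtain rfl := hz p hp (le_antisymm this hp0)
          exact mem_bandUnion.2 (Or.inr ⟨(p.1, {p.2}), by simp [h𝒱'], rfl, rfl⟩)
      · refine mem_bandUnion.2 (Or.inr ⟨(v.1, v.2 ∩ {y | 0 ≤ ψ (v.1, y)}), ?_, hpv1, hpv2, ?_⟩)
        · rw [h𝒱', Finset.mem_coe, Finset.mem_insert]
          exact Or.inr (Finset.mem_image_of_mem _ hv)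
        · change 0 ≤ ψ (v.1, p.2)
          rwa [← hpv1]
    · intro hp
      rcases mem_bandUnion.1 hp with ⟨σ, hσ, hpσ⟩ | ⟨v, hv, hpv1, hpv2⟩
      · obtain ⟨hσ, h⟩ := Finset.mem_filter.1 hσ
        exact ⟨mem_bandUnion.2 (Or.inl ⟨σ, hσ, hpσ⟩),
          closure_minimal (fun r hr => (h r hr.1 hr.2).le)
            (isClosed_le continuous_const hψ) ((h𝒟.isBand σ hσ).subset_closure_core hpσ)⟩
      · rw [h𝒱', Finset.mem_coe, Finset.mem_insert] at hv
        rcases hv with rfl | hv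
        · obtain rfl : p = z := Prod.ext hpv1 hpv2
          exact ⟨hzT, hz0.ge⟩
        · obtain ⟨w, hw, rfl⟩ := Finset.mem_image.1 hv
          refine ⟨mem_bandUnion.2 (Or.inr ⟨w, hw, hpv1, hpv2.1⟩), ?_⟩
          have : 0 ≤ ψ (w.1, p.2) := hpv2.2
          change 0 ≤ ψ (p.1, p.2)
          rwa [hpv1]
  rw [heq] at hconn ⊢
  refine ih 𝒟' 𝒱' hcard (h𝒟.mono hsub) ?_ hconn
  intro v hv
  rw [h𝒱', Finset.mem_coe, Finset.mem_insert] at hv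
  rcases hv with rfl | hv
  · refine ⟨hzB, isClosed_singleton, ordConnected_singleton, ?_⟩
    rw [singleton_prod_singleton, singleton_subset_iff]
    exact bandUnion_subset h𝒟 h𝒱 hzT
  · obtain ⟨w, hw, rfl⟩ := Finset.mem_image.1 hv
    obtain ⟨h1, h2, h3, h4⟩ := h𝒱 w hw
    refine ⟨h1, h2.inter (isClosed_le continuous_const (hψ.comp (by fun_prop))),
      h3.inter (hord _), (prod_mono_right inter_subset_left).trans h4⟩

/-- The inductive step when two bands are joined at the left end of the union. -/
theorem isExtensor_of_joined {𝒟 : Finset Band} {𝒱 : Finset (ℝ × Set ℝ)}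
    (ih : ∀ (𝒟' : Finset Band) (𝒱' : Finset (ℝ × Set ℝ)), 𝒟'.card < 𝒟.card →
      IsBandSystem B X 𝒟' → IsSegmentSystem B X 𝒱' → IsConnected (bandUnion 𝒟' 𝒱') →
      IsExtensor (bandUnion 𝒟' 𝒱'))
    (h𝒟 : IsBandSystem B X 𝒟) (h𝒱 : IsSegmentSystem B X 𝒱) (hconn : IsConnected (bandUnion 𝒟 𝒱))
    {σ τ : Band} (hσ : σ ∈ 𝒟) (hτ : τ ∈ 𝒟) (hστ : σ.Below B τ) {a : ℝ} (ha : a ∈ σ.base)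
    (hl : ∀ p ∈ bandUnion (𝒟 : Set Band) (𝒱 : Set (ℝ × Set ℝ)), a ≤ p.1)
    (hseg : ∀ h ∈ σ.up, ∀ g ∈ τ.lo, ∀ y ∈ Icc (h a) (g a), (a, y) ∈ bandUnion (𝒟 : Set Band) 𝒱) :
    IsExtensor (bandUnion (𝒟 : Set Band) (𝒱 : Set (ℝ × Set ℝ))) := by
  set T := bandUnion (𝒟 : Set Band) (𝒱 : Set (ℝ × Set ℝ)) with hT
  have hbσ := h𝒟.isBand σ hσ
  have hla : a ∈ lowerBounds σ.base := fun x hx =>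
    hl _ (mem_bandUnion.2 (Or.inl ⟨σ, hσ, hbσ.clamp_mem hx 0⟩))
  have haB := hbσ.strip.mem_of_lowerBound ha hla
  -- Replacing `τ` by the nearest band above `σ` leaves no band in between, and the new gap at `a`
  -- is contained in the old one.
  obtain ⟨υ, hυ, hσυ, hnear⟩ := exists_nearest_above h𝒟 𝒟.finite_toSet hσ hτ hστ
  have hbυ := h𝒟.isBand υ hυ
  obtain ⟨hbase, h, hh, g, hg, hlt⟩ := id hσυ
  have hsegυ : ∀ y ∈ Icc (h a) (g a), (a, y) ∈ T := by
    intro y hy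
    obtain ⟨-, h', hh', k, hk, hlt'⟩ := id hστ
    refine hseg h hh k hk y ⟨hy.1, hy.2.trans ?_⟩
    rcases hnear τ hτ hστ with rfl | ⟨hυτ, l, hl, k', hk', hlk⟩
    · rw [Option.mem_unique hg hk]
    · obtain rfl := Option.mem_unique hk hk'
      have haυ : a ∈ υ.base := hbase ▸ ha
      exact (hbυ.le hg hl haυ).trans (closure_minimal (fun y hy => (hlk y hy).le)
        (isClosed_le l.continuous k.continuous) (hbυ.strip.subset_closure haυ))
  obtain ⟨φ, hφ, hφa, c, hc, hmid, hout⟩ := exists_graph_between hbσ hbυ hbase hh hg hlt ha hla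
    (fun y hy => bandUnion_subset h𝒟 h𝒱 (hsegυ y hy))
  have hac : a < c := lt_of_le_of_ne (hla hc.1) (by rintro rfl; exact hc.2 haB)
  have hzT : (a, φ a) ∈ T := hsegυ _ hφa
  -- Right of `c` the graph is outside `X`; between `a` and `c` it runs in a gap free of bands and
  -- over no point of `B`; nothing of `T` lies left of `a`.
  have hz : ∀ p ∈ T, p.2 = φ p.1 → p = (a, φ a) := by
    intro p hp hpφ
    rcases (hl p hp).eq_or_lt with hpa | hpa
    · exact Prod.ext hpa.symm (by rw [hpφ, ← hpa])
    exfalso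
    rcases lt_or_ge c p.1 with hpc | hpc
    · refine hout p.1 hpc ?_
      rw [← hpφ]
      exact bandUnion_subset h𝒟 h𝒱 hp
    have hpS : p.1 ∈ σ.base \ B := by
      have h1 := hbσ.strip.ordConnected.out ha hc.1 ⟨hpa.le, hpc⟩
      refine ⟨h1, fun h2 => ?_⟩
      rcases hbσ.strip.bound_of_mem h1 h2 with h3 | h3
      · exact (h3 ha).not_gt hpa
      · exact hc.2 (le_antisymm hpc (h3 hc.1) ▸ h2)
    obtain ⟨hm1, hm2⟩ := hmid p.1 hpa hpc
    rcases mem_bandUnion.1 hp with ⟨κ, hκ, hpκ⟩ | ⟨v, hv, hpv, -⟩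
    · by_cases hκσ : κ = σ
      · subst hκσ
        have := hpκ.2.2 h hh
        linarith
      rcases h𝒟.pairwise κ hκ σ hσ hκσ with hd | hd | hd
      · exact hd.2 p.1 hpS hpκ.1
      · obtain ⟨hb', k, hk, l, hl', hkl⟩ := hd
        have h1 := hpκ.2.2 k hk
        have h2 := hkl p.1 (hb' ▸ hpS)
        have h3 := hbσ.lt l hl' h hh p.1 hpS
        linarith
      · rcases hnear κ hκ hd with rfl | hd'
        · have := hpκ.2.1 g hg
          linarith
        · obtain ⟨hb', k, hk, l, hl', hkl⟩ := hd'
          have h1 := hpκ.2.1 l hl'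
          have h2 := hkl p.1 (hbase ▸ hpS)
          have h3 := hbυ.lt g hg k hk p.1 (hbase ▸ hpS)
          linarith
    · exact hpS.2 (hpv ▸ (h𝒱 v hv).1)
  have hTc : IsClosed T := isClosed_bandUnion h𝒟 h𝒱 𝒟.finite_toSet 𝒱.finite_toSet
  set ψ : ℝ × ℝ → ℝ := fun p => φ p.1 - p.2 with hψ
  have hψc : Continuous ψ := by fun_prop
  have hA : IsClosed (T ∩ {p | 0 ≤ ψ p}) := hTc.inter (isClosed_le continuous_const hψc)
  have hBc : IsClosed (T ∩ {p | 0 ≤ -ψ p}) := hTc.inter (isClosed_le continuous_const hψc.neg)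
  have hU : (T ∩ {p | 0 ≤ ψ p}) ∪ (T ∩ {p | 0 ≤ -ψ p}) = T := by
    rw [← inter_union_distrib_left, inter_eq_left]
    intro p _
    rcases le_total 0 (ψ p) with h | h
    · exact Or.inl h
    · exact Or.inr (neg_nonneg.2 h)
  have hI : (T ∩ {p | 0 ≤ ψ p}) ∩ (T ∩ {p | 0 ≤ -ψ p}) = {(a, φ a)} := by
    ext p
    constructor
    · rintro ⟨⟨hp, h1⟩, -, h2⟩
      have h1 : 0 ≤ φ p.1 - p.2 := h1
      have h2 : 0 ≤ -(φ p.1 - p.2) := h2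
      exact hz p hp (by linarith)
    · rintro rfl
      exact ⟨⟨hzT, show 0 ≤ φ a - φ a by simp⟩, hzT, show 0 ≤ -(φ a - φ a) by simp⟩
  have hIp : IsPreconnected ((T ∩ {p | 0 ≤ ψ p}) ∩ (T ∩ {p | 0 ≤ -ψ p})) :=
    hI ▸ isPreconnected_singleton
  have hAconn : IsConnected (T ∩ {p | 0 ≤ ψ p}) :=
    ⟨⟨_, hzT, show 0 ≤ φ a - φ a by simp⟩,
      IsPreconnected.left_of_union hA hBc (hU.symm ▸ hconn.isPreconnected) hIp⟩
  have hBconn : IsConnected (T ∩ {p | 0 ≤ -ψ p}) :=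
    ⟨⟨_, hzT, show 0 ≤ -(φ a - φ a) by simp⟩,
      IsPreconnected.left_of_union hBc hA (by rw [union_comm, hU]; exact hconn.isPreconnected)
        (by rwa [inter_comm])⟩
  -- Over `c`, the bottom of `υ` and the top of `σ` lie strictly on opposite sides of the graph, so
  -- each half loses a band.
  obtain ⟨hm1, hm2⟩ := hmid c hac le_rfl
  have e1 : IsExtensor (T ∩ {p | 0 ≤ ψ p}) :=
    isExtensor_half ih h𝒟 h𝒱 hψc
      (fun x => ⟨fun y _ w hw t ht => by
        change 0 ≤ φ x - t
        have : 0 ≤ φ x - w := hw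
        linarith [ht.2]⟩) hzT haB (by simp [hψ])
      (fun p hp h0 => hz p hp (by simp only [hψ] at h0; linarith)) hυ (q := (c, g c))
      ⟨hbase ▸ hc.1, fun k hk => (Option.mem_unique hg hk ▸ le_rfl),
        fun k hk => hbυ.le hg hk (hbase ▸ hc.1)⟩ hc.2
      (by simp only [hψ]; linarith) hAconn
  have e2 : IsExtensor (T ∩ {p | 0 ≤ -ψ p}) :=
    isExtensor_half ih h𝒟 h𝒱 hψc.neg
      (fun x => ⟨fun y hy w _ t ht => by
        change 0 ≤ -(φ x - t)
        have : 0 ≤ -(φ x - y) := hy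
        linarith [ht.1]⟩) hzT haB (by simp [hψ])
      (fun p hp h0 => hz p hp (by simp only [hψ] at h0; linarith)) hσ (q := (c, h c))
      ⟨hc.1, fun k hk => hbσ.le hk hh hc.1, fun k hk => (Option.mem_unique hh hk ▸ le_rfl)⟩ hc.2
      (by simp only [hψ]; linarith) hBconn
  rw [← hU]
  exact e1.union e2 hA hBc (hI ▸ isExtensor_singleton _)

end SeparatingGraph

/-! ### Connected unions of bands and segments are extensors. -/

section Gluing

variable {B : Set ℝ} {X : Set (ℝ × ℝ)}

/-- The projection to the abscissa is connected and finite, hence a point, so the union is one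
vertical interval. -/
theorem isExtensor_segments {𝒱 : Set (ℝ × Set ℝ)} (hf : 𝒱.Finite)
    (hconn : IsConnected (bandUnion ∅ 𝒱)) : IsExtensor (bandUnion ∅ 𝒱) := by
  set T := bandUnion ∅ 𝒱 with hT
  have hsub : (Prod.fst '' T) ⊆ Prod.fst '' 𝒱 := by
    rintro _ ⟨p, hp, rfl⟩
    rcases mem_bandUnion.1 hp with ⟨σ, hσ, -⟩ | ⟨v, hv, hpv, -⟩
    · exact hσ.elim
    · exact ⟨v, hv, hpv.symm⟩
  have hss : (Prod.fst '' T).Subsingleton :=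
    ((hf.image Prod.fst).countable.mono hsub).isTotallyDisconnected _ subset_rfl
      (hconn.isPreconnected.image _ continuous_fst.continuousOn)
  obtain ⟨q, hq⟩ := hconn.nonempty
  have hTeq : T = {q.1} ×ˢ (Prod.snd '' T) := by
    ext p
    constructor
    · intro hp
      exact ⟨hss ⟨p, hp, rfl⟩ ⟨q, hq, rfl⟩, p, hp, rfl⟩
    · rintro ⟨hp1, r, hr, hrp⟩
      have h1 : r.1 = q.1 := hss ⟨r, hr, rfl⟩ ⟨q, hq, rfl⟩
      have h2 : p.1 = q.1 := hp1
      rwa [show p = r from Prod.ext (h2.trans h1.symm) hrp.symm]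
  rw [hTeq]
  exact (isExtensor_singleton _).prod (isExtensor_ordConnected
    (hconn.isPreconnected.image _ continuous_snd.continuousOn).ordConnected ⟨_, q, hq, rfl⟩)

theorem IsBandSystem.base_eq_or {𝒟 : Set Band} (h𝒟 : IsBandSystem B X 𝒟) {σ τ : Band}
    (hσ : σ ∈ 𝒟) (hτ : τ ∈ 𝒟) : σ.base = τ.base ∨
      ((∀ x ∈ σ.base \ B, x ∉ τ.base) ∧ ∀ x ∈ τ.base \ B, x ∉ σ.base) := by
  by_cases h : σ = τ
  · exact Or.inl (h ▸ rfl)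
  · rcases h𝒟.pairwise σ hσ τ hτ h with h | h | h
    exacts [Or.inr h, Or.inl h.1, Or.inl h.1.symm]

theorem IsBandSystem.below_or {𝒟 : Set Band} (h𝒟 : IsBandSystem B X 𝒟) {σ τ : Band}
    (hσ : σ ∈ 𝒟) (hτ : τ ∈ 𝒟) (hne : σ ≠ τ) (hb : σ.base = τ.base) :
    σ.Below B τ ∨ τ.Below B σ := by
  rcases h𝒟.pairwise σ hσ τ hτ hne with h | h
  · obtain ⟨c, hc⟩ := (h𝒟.isBand σ hσ).strip.nonempty
    exact (h.1 c hc (hb ▸ hc.1)).elim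
  · exact h

/-- In a finite system of bands, one strip lies to the left of all others. -/
theorem IsBandSystem.exists_leftmost {𝒟 : Set Band} (h𝒟 : IsBandSystem B X 𝒟) (hf : 𝒟.Finite)
    (hne : 𝒟.Nonempty) : ∃ σ ∈ 𝒟, ∀ τ ∈ 𝒟, τ.base = σ.base ∨
      ∀ x ∈ σ.base \ B, ∀ y ∈ τ.base, x < y := by
  choose! s hs using fun σ hσ => (h𝒟.isBand σ hσ).strip.nonempty
  obtain ⟨σ, hσ, hmin⟩ := Set.exists_min_image 𝒟 s hf hne
  refine ⟨σ, hσ, fun τ hτ => ?_⟩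
  rcases h𝒟.base_eq_or hτ hσ with h | ⟨h1, h2⟩
  · exact Or.inl h
  · refine Or.inr fun x hx y hy => ?_
    by_contra! hyx
    rcases le_or_gt y (s σ) with h3 | h3
    · exact h2 _ (hs σ hσ) ((h𝒟.isBand τ hτ).strip.ordConnected.out hy (hs τ hτ).1 ⟨h3, hmin τ hτ⟩)
    · exact h2 y ((h𝒟.isBand σ hσ).strip.ordConnected_diff.out (hs σ hσ) hx ⟨h3.le, hyx⟩) hy

theorem IsStrip.mem_lowerBounds {S : Set ℝ} (hS : IsStrip B S) {a : ℝ}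
    (h : ∀ x ∈ S \ B, a ≤ x) : a ∈ lowerBounds S := fun _ hx =>
  closure_minimal (t := Ici a) h isClosed_Ici (hS.subset_closure hx)

theorem IsStrip.mem_upperBounds {S : Set ℝ} (hS : IsStrip B S) {a : ℝ}
    (h : ∀ x ∈ S \ B, x ≤ a) : a ∈ upperBounds S := fun _ hx =>
  closure_minimal (t := Iic a) h isClosed_Iic (hS.subset_closure hx)

theorem inter_nonempty_of_isPreconnected_union {E : Type*} [TopologicalSpace E] {P Q : Set E}
    (hP : IsClosed P) (hQ : IsClosed Q) (h : IsPreconnected (P ∪ Q)) (hPn : P.Nonempty)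
    (hQn : Q.Nonempty) : (P ∩ Q).Nonempty := by
  obtain ⟨z, -, hz⟩ := isPreconnected_closed_iff.1 h P Q hP hQ subset_rfl
    (hPn.mono fun x hx => ⟨Or.inl hx, hx⟩) (hQn.mono fun x hx => ⟨Or.inr hx, hx⟩)
  exact ⟨z, hz⟩

/-- Two bands over the leftmost strip which both meet a vertical interval contained in the union
at the left end are joined. -/
theorem isExtensor_of_both_meet {𝒟 : Finset Band} {𝒱 : Finset (ℝ × Set ℝ)}
    (ih : ∀ (𝒟' : Finset Band) (𝒱' : Finset (ℝ × Set ℝ)), 𝒟'.card < 𝒟.card →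
      IsBandSystem B X 𝒟' → IsSegmentSystem B X 𝒱' → IsConnected (bandUnion 𝒟' 𝒱') →
      IsExtensor (bandUnion 𝒟' 𝒱'))
    (h𝒟 : IsBandSystem B X 𝒟) (h𝒱 : IsSegmentSystem B X 𝒱) (hconn : IsConnected (bandUnion 𝒟 𝒱))
    {σ τ : Band} (hσ : σ ∈ 𝒟) (hτ : τ ∈ 𝒟) (hne : σ ≠ τ) (hb : σ.base = τ.base) {a : ℝ}
    (ha : a ∈ σ.base) (hl : ∀ p ∈ bandUnion (𝒟 : Set Band) (𝒱 : Set (ℝ × Set ℝ)), a ≤ p.1)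
    {I : Set ℝ} (hI : I.OrdConnected) (hIT : ∀ y ∈ I, (a, y) ∈ bandUnion (𝒟 : Set Band) 𝒱)
    {y₁ y₂ : ℝ} (h₁ : y₁ ∈ I) (h₁' : (a, y₁) ∈ σ.carrier) (h₂ : y₂ ∈ I)
    (h₂' : (a, y₂) ∈ τ.carrier) :
    IsExtensor (bandUnion (𝒟 : Set Band) (𝒱 : Set (ℝ × Set ℝ))) := by
  rcases h𝒟.below_or hσ hτ hne hb with h | h
  · exact isExtensor_of_joined ih h𝒟 h𝒱 hconn hσ hτ h ha hl fun k hk g hg y hy =>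
      hIT y (hI.out h₁ h₂ ⟨(h₁'.2.2 k hk).trans hy.1, hy.2.trans (h₂'.2.1 g hg)⟩)
  · exact isExtensor_of_joined ih h𝒟 h𝒱 hconn hτ hσ h (hb ▸ ha) hl fun k hk g hg y hy =>
      hIT y (hI.out h₂ h₁ ⟨(h₂'.2.2 k hk).trans hy.1, hy.2.trans (h₁'.2.1 g hg)⟩)

set_option maxHeartbeats 400000 in
/-- A connected finite union of bands and vertical segments is an extensor. -/
theorem isExtensor_bandUnion (𝒟 : Finset Band) (𝒱 : Finset (ℝ × Set ℝ))
    (h𝒟 : IsBandSystem B X 𝒟) (h𝒱 : IsSegmentSystem B X 𝒱)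
    (hconn : IsConnected (bandUnion 𝒟 𝒱)) : IsExtensor (bandUnion 𝒟 𝒱) := by
  classical
  -- Lexicographic induction: the number of segments may grow whenever the number of bands drops.
  induction hn : 𝒟.card using Nat.strong_induction_on generalizing 𝒟 𝒱 with
  | _ n ihn =>
  induction hm : 𝒱.card using Nat.strong_induction_on generalizing 𝒱 with
  | _ m ihm =>
  have ih : ∀ (𝒟' : Finset Band) (𝒱' : Finset (ℝ × Set ℝ)), 𝒟'.card < 𝒟.card →
      IsBandSystem B X 𝒟' → IsSegmentSystem B X 𝒱' → IsConnected (bandUnion 𝒟' 𝒱') →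
      IsExtensor (bandUnion 𝒟' 𝒱') := fun 𝒟' 𝒱' hlt h1 h2 h3 =>
    ihn 𝒟'.card (hn ▸ hlt) 𝒟' 𝒱' h1 h2 h3 rfl
  have ih' : ∀ 𝒱' : Finset (ℝ × Set ℝ), 𝒱'.card < 𝒱.card →
      IsSegmentSystem B X 𝒱' → IsConnected (bandUnion 𝒟 𝒱') →
      IsExtensor (bandUnion 𝒟 𝒱') := fun 𝒱' hlt h2 h3 =>
    ihm 𝒱'.card (hm ▸ hlt) 𝒱' h2 h3 rfl
  clear ihn ihm
  rcases 𝒟.eq_empty_or_nonempty with rfl | hne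
  · rw [Finset.coe_empty] at hconn ⊢
    exact isExtensor_segments 𝒱.finite_toSet hconn
  obtain ⟨σ, hσ, hleft⟩ := h𝒟.exists_leftmost 𝒟.finite_toSet hne
  have hbσ := h𝒟.isBand σ hσ
  obtain ⟨c, hc⟩ := hbσ.strip.nonempty
  have hband : ∀ {a : ℝ}, (∀ x ∈ σ.base \ B, a ≤ x) → ∀ τ ∈ 𝒟, ∀ x ∈ τ.base, a ≤ x := by
    intro a ha τ hτ x hx
    rcases hleft τ hτ with h | h
    · exact hbσ.strip.mem_lowerBounds ha (h ▸ hx)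
    · exact (ha c hc).trans (h c hc x hx).le
  have hbase : ∀ {a : ℝ}, (∀ x ∈ σ.base \ B, a ≤ x) → ∀ τ ∈ 𝒟, a ∈ τ.base → τ.base = σ.base := by
    intro a ha τ hτ hx
    rcases hleft τ hτ with h | h
    · exact h
    · exact absurd (ha c hc) (not_le.2 (h c hc a hx))
  by_cases hcase : ∃ v ∈ 𝒱, v.2.Nonempty ∧ ∀ x ∈ σ.base \ B, v.1 < x
  · obtain ⟨v, ⟨hv, hvne⟩, hvmin⟩ := Set.exists_min_image {v ∈ (𝒱 : Set (ℝ × Set ℝ)) | v.2.Nonempty}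
      Prod.fst (𝒱.finite_toSet.subset (sep_subset _ _))
      (by obtain ⟨v, hv, hvne, -⟩ := hcase; exact ⟨v, hv, hvne⟩)
    have hvlt : ∀ x ∈ σ.base \ B, v.1 < x := by
      obtain ⟨w, hw, hwne, hw'⟩ := hcase
      exact fun x hx => (hvmin w ⟨hw, hwne⟩).trans_lt (hw' x hx)
    have hvle : ∀ x ∈ σ.base \ B, v.1 ≤ x := fun x hx => (hvlt x hx).le
    obtain ⟨hvB, hvc, hvo, hvX⟩ := h𝒱 v hv
    have hl : ∀ p ∈ bandUnion (𝒟 : Set Band) (𝒱 : Set (ℝ × Set ℝ)), v.1 ≤ p.1 := by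
      intro p hp
      rcases mem_bandUnion.1 hp with ⟨τ, hτ, hpτ⟩ | ⟨w, hw, hpw, hpw'⟩
      · exact hband hvle τ hτ _ hpτ.1
      · exact hpw ▸ hvmin w ⟨hw, _, hpw'⟩
    have hVT : ∀ y ∈ v.2, (v.1, y) ∈ bandUnion (𝒟 : Set Band) (𝒱 : Set (ℝ × Set ℝ)) :=
      fun y hy => mem_bandUnion.2 (Or.inr ⟨v, hv, rfl, hy⟩)
    -- Here `v` is a leftmost segment, at or beyond the left end of the leftmost strip. A segment
    -- overlapping it is merged with it, which lowers the number of segments.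
    by_cases hmerge : ∃ w ∈ 𝒱, w ≠ v ∧ w.1 = v.1 ∧ (v.2 ∩ w.2).Nonempty
    · obtain ⟨w, hw, hwv, hw1, y, hyv, hyw⟩ := hmerge
      obtain ⟨hwB, hwc, hwo, hwX⟩ := h𝒱 w hw
      set 𝒱' := insert (v.1, v.2 ∪ w.2) ((𝒱.erase v).erase w) with h𝒱'
      have heq : bandUnion (𝒟 : Set Band) (𝒱 : Set (ℝ × Set ℝ)) = bandUnion 𝒟 𝒱' := by
        ext p
        simp only [mem_bandUnion, h𝒱', Finset.mem_coe, Finset.mem_insert, Finset.mem_erase]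
        refine or_congr_right ⟨?_, ?_⟩
        · rintro ⟨u, hu, hpu, hpu'⟩
          by_cases huv : u = v
          · exact ⟨_, Or.inl rfl, huv ▸ hpu, Or.inl (huv ▸ hpu')⟩
          by_cases huw : u = w
          · exact ⟨_, Or.inl rfl, (huw ▸ hpu : p.1 = w.1).trans hw1, Or.inr (huw ▸ hpu')⟩
          · exact ⟨u, Or.inr ⟨huw, huv, hu⟩, hpu, hpu'⟩
        · rintro ⟨u, rfl | ⟨-, -, hu⟩, hpu, hpu'⟩
          · rcases hpu' with h | h
            · exact ⟨v, hv, hpu, h⟩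
            · exact ⟨w, hw, hpu.trans hw1.symm, h⟩
          · exact ⟨u, hu, hpu, hpu'⟩
      rw [heq] at hconn ⊢
      refine ih' 𝒱' ?_ ?_ hconn
      · have h1 := Finset.card_insert_le (v.1, v.2 ∪ w.2) ((𝒱.erase v).erase w)
        have h2 := Finset.card_erase_lt_of_mem hv
        have h3 := Finset.card_erase_lt_of_mem (Finset.mem_erase.2 ⟨hwv, hw⟩)
        rw [← h𝒱'] at h1
        omega
      · intro u hu
        rw [h𝒱', Finset.mem_coe, Finset.mem_insert] at hu
        rcases hu with rfl | hu
        · refine ⟨hvB, hvc.union hwc,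
            (hvo.isPreconnected.union y hyv hyw hwo.isPreconnected).ordConnected, ?_⟩
          rw [prod_union]
          exact union_subset hvX (hw1 ▸ hwX)
        · exact h𝒱 u (Finset.mem_of_mem_erase (Finset.mem_of_mem_erase hu))
    by_cases htwo : ∃ τ ∈ 𝒟, ∃ υ ∈ 𝒟, τ ≠ υ ∧ (v.2 ∩ τ.fiber v.1).Nonempty ∧
        (v.2 ∩ υ.fiber v.1).Nonempty
    · obtain ⟨τ, hτ, υ, hυ, hne, ⟨y₁, h₁, h₁'⟩, y₂, h₂, h₂'⟩ := htwo
      exact isExtensor_of_both_meet ih h𝒟 h𝒱 hconn hτ hυ hne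
        ((hbase hvle τ hτ h₁'.1).trans (hbase hvle υ hυ h₂'.1).symm) h₁'.1 hl hvo hVT
        h₁ h₁' h₂ h₂'
    have h𝒱' : IsSegmentSystem B X (𝒱.erase v) := fun w hw => h𝒱 w (Finset.mem_of_mem_erase hw)
    set R := bandUnion (𝒟 : Set Band) ((𝒱.erase v : Finset _) : Set (ℝ × Set ℝ)) with hR
    have hU : {v.1} ×ˢ v.2 ∪ R = bandUnion (𝒟 : Set Band) (𝒱 : Set (ℝ × Set ℝ)) := by
      ext p
      simp only [hR, mem_bandUnion, Finset.mem_coe, Finset.mem_erase, mem_union]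
      constructor
      · rintro (hp | hp | ⟨w, hw, hpw⟩)
        · exact Or.inr ⟨v, hv, hp⟩
        · exact Or.inl hp
        · exact Or.inr ⟨w, hw.2, hpw⟩
      · rintro (hp | ⟨w, hw, hpw⟩)
        · exact Or.inr (Or.inl hp)
        · by_cases hwv : w = v
          · exact Or.inl (hwv ▸ hpw)
          · exact Or.inr (Or.inr ⟨w, ⟨hwv, hw⟩, hpw⟩)
    have hVc : IsClosed ({v.1} ×ˢ v.2) := isClosed_singleton.prod hvc
    have hRc : IsClosed R := isClosed_bandUnion h𝒟 h𝒱' 𝒟.finite_toSet (Finset.finite_toSet _)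
    have hRne : R.Nonempty := ⟨_, mem_bandUnion.2 (Or.inl ⟨σ, hσ, hbσ.clamp_mem hc.1 0⟩)⟩
    rw [← hU] at hconn ⊢
    have hband' : ∀ p ∈ {v.1} ×ˢ v.2 ∩ R, ∃ τ ∈ 𝒟, p ∈ τ.carrier := by
      rintro p ⟨hpv, hpR⟩
      rcases mem_bandUnion.1 hpR with h | ⟨w, hw, hpw, hpw'⟩
      · exact h
      · obtain ⟨hwv, hw⟩ := Finset.mem_erase.1 hw
        exact absurd ⟨w, hw, hwv, hpw.symm.trans hpv.1, p.2, hpv.2, hpw'⟩ hmerge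
    obtain ⟨p, hpVR⟩ := inter_nonempty_of_isPreconnected_union hVc hRc hconn.isPreconnected
      ((singleton_nonempty _).prod hvne) hRne
    obtain ⟨τ, hτ, hpτ⟩ := hband' p hpVR
    have hp1 : p.1 = v.1 := hpVR.1.1
    have hpf : p.2 ∈ v.2 ∩ τ.fiber v.1 := ⟨hpVR.1.2, show (v.1, p.2) ∈ τ.carrier from hp1 ▸ hpτ⟩
    -- Only one band meets `v`, and no other segment does, so `v` is attached to the rest along an
    -- interval.
    have hI : {v.1} ×ˢ v.2 ∩ R = {v.1} ×ˢ (v.2 ∩ τ.fiber v.1) := by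
      ext q
      constructor
      · intro hq
        obtain ⟨υ, hυ, hqυ⟩ := hband' q hq
        have hq1 : q.1 = v.1 := hq.1.1
        have hqf : q.2 ∈ v.2 ∩ υ.fiber v.1 :=
          ⟨hq.1.2, show (v.1, q.2) ∈ υ.carrier from hq1 ▸ hqυ⟩
        by_cases hυτ : υ = τ
        · exact ⟨hq1, hυτ ▸ hqf⟩
        · exact absurd ⟨υ, hυ, τ, hτ, hυτ, ⟨_, hqf⟩, ⟨_, hpf⟩⟩ htwo
      · rintro ⟨hq1, hq2, hq3⟩
        have hq1 : q.1 = v.1 := hq1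
        refine ⟨⟨hq1, hq2⟩, mem_bandUnion.2 (Or.inl ⟨τ, hτ, ?_⟩)⟩
        have : (v.1, q.2) ∈ τ.carrier := hq3
        rwa [← hq1] at this
    have hIo : (v.2 ∩ τ.fiber v.1).OrdConnected := hvo.inter (τ.ordConnected_fiber _)
    have hRconn : IsConnected R := ⟨hRne, IsPreconnected.left_of_union hRc hVc
      (by rw [union_comm]; exact hconn.isPreconnected)
      (by rw [inter_comm, hI]; exact isPreconnected_singleton.prod hIo.isPreconnected)⟩
    refine IsExtensor.union ((isExtensor_singleton _).prod (isExtensor_ordConnected hvo hvne))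
      (ih' _ (Finset.card_erase_lt_of_mem hv) h𝒱' hRconn) hVc hRc ?_
    rw [hI]
    exact (isExtensor_singleton _).prod (isExtensor_ordConnected hIo ⟨_, hpf⟩)
  push Not at hcase
  have hseg : ∀ v ∈ 𝒱, v.2.Nonempty → ∀ x ∈ σ.base \ B, x ≤ v.1 := by
    intro v hv hvne x hx
    obtain ⟨y, hy, hyv⟩ := hcase v hv hvne
    by_contra! hlt
    exact (hbσ.strip.ordConnected_diff.out hy hx ⟨hyv, hlt.le⟩).2 (h𝒱 v hv).1
  by_cases htouch : ∃ τ ∈ 𝒟, τ ≠ σ ∧ ∃ p ∈ σ.carrier, p ∈ τ.carrier ∧ p.1 ∈ lowerBounds σ.base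
  · obtain ⟨τ, hτ, hne, p, hpσ, hpτ, hpl⟩ := htouch
    have hle : ∀ x ∈ σ.base \ B, p.1 ≤ x := fun x hx => hpl hx.1
    refine isExtensor_of_both_meet ih h𝒟 h𝒱 hconn hσ hτ hne.symm (hbase hle τ hτ hpτ.1).symm
      (a := p.1) hpσ.1 ?_ (I := {p.2}) ordConnected_singleton ?_ rfl hpσ rfl hpτ
    · intro q hq
      rcases mem_bandUnion.1 hq with ⟨τ, hτ, hqτ⟩ | ⟨w, hw, hqw, hqw'⟩
      · exact hband hle τ hτ _ hqτ.1
      · exact (hle c hc).trans (hqw ▸ hseg w hw ⟨_, hqw'⟩ c hc)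
    · rintro y rfl
      exact mem_bandUnion.2 (Or.inl ⟨σ, hσ, hpσ⟩)
  push Not at htouch
  have h𝒟' : IsBandSystem B X (𝒟.erase σ) :=
    h𝒟.mono (Finset.coe_subset.2 (Finset.erase_subset _ _))
  -- With no segment and no other band touching `σ` on the left, `σ` can meet the rest only over its
  -- right end.
  have hright : ∀ p ∈ σ.carrier, p ∈ bandUnion ((𝒟.erase σ : Finset _) : Set Band) 𝒱 →
      p.1 ∈ upperBounds σ.base := by
    intro p hpσ hp
    rcases mem_bandUnion.1 hp with ⟨τ, hτ, hpτ⟩ | ⟨w, hw, hpw, hpw'⟩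
    · obtain ⟨hne, hτ⟩ := Finset.mem_erase.1 hτ
      by_cases hpB : p.1 ∈ B
      · rcases hbσ.strip.bound_of_mem hpσ.1 hpB with h | h
        · exact absurd h (htouch τ hτ hne p hpσ hpτ)
        · exact h
      · exfalso
        rcases h𝒟.pairwise τ hτ σ hσ hne with h | h | h
        · exact h.2 p.1 ⟨hpσ.1, hpB⟩ hpτ.1
        · obtain ⟨-, k, hk, g, hg, hkg⟩ := h
          have := hkg p.1 ⟨hpτ.1, hpB⟩
          linarith [hpτ.2.2 k hk, hpσ.2.1 g hg]
        · obtain ⟨-, k, hk, g, hg, hkg⟩ := h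
          have := hkg p.1 ⟨hpσ.1, hpB⟩
          linarith [hpσ.2.2 k hk, hpτ.2.1 g hg]
    · exact hbσ.strip.mem_upperBounds (hpw ▸ hseg w hw ⟨_, hpw'⟩)
  have hU : σ.carrier ∪ bandUnion ((𝒟.erase σ : Finset _) : Set Band) (𝒱 : Set (ℝ × Set ℝ)) =
      bandUnion (𝒟 : Set Band) (𝒱 : Set (ℝ × Set ℝ)) := by
    ext p
    simp only [mem_bandUnion, Finset.mem_coe, Finset.mem_erase, mem_union]
    constructor
    · rintro (hp | ⟨w, hw, hpw⟩ | hp)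
      · exact Or.inl ⟨σ, hσ, hp⟩
      · exact Or.inl ⟨w, hw.2, hpw⟩
      · exact Or.inr hp
    · rintro (⟨w, hw, hpw⟩ | hp)
      · by_cases hwv : w = σ
        · exact Or.inl (hwv ▸ hpw)
        · exact Or.inr (Or.inl ⟨w, ⟨hwv, hw⟩, hpw⟩)
      · exact Or.inr (Or.inr hp)
  have hσne : σ.carrier.Nonempty := ⟨_, hbσ.clamp_mem hc.1 0⟩
  by_cases hb : ∃ b ∈ σ.base, b ∈ upperBounds σ.base
  · obtain ⟨b, hbS, hbu⟩ := hb
    -- Adding the right edge of `σ` to the rest makes the intersection with `σ` exactly this edge,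
    -- an interval, instead of an arbitrary closed part of it.
    set 𝒱' := insert (b, σ.fiber b) 𝒱 with h𝒱'
    set R := bandUnion ((𝒟.erase σ : Finset _) : Set Band) (𝒱' : Set (ℝ × Set ℝ)) with hR
    have hRmem : ∀ p, p ∈ R ↔ (p.1 = b ∧ p ∈ σ.carrier) ∨
        p ∈ bandUnion ((𝒟.erase σ : Finset _) : Set Band) (𝒱 : Set (ℝ × Set ℝ)) := by
      intro p
      have haux : (p.1 = b ∧ p ∈ σ.carrier) ↔ (p.1 = b ∧ p.2 ∈ σ.fiber b) :=
        and_congr_right fun h => by rw [← h]; rfl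
      simp only [hR, h𝒱', mem_bandUnion, Finset.mem_coe, Finset.mem_insert, haux,
        or_and_right, exists_or, exists_eq_left]
      rw [or_left_comm]
    have hsegs : IsSegmentSystem B X 𝒱' := by
      intro v hv
      rw [h𝒱', Finset.mem_coe, Finset.mem_insert] at hv
      rcases hv with rfl | hv
      · refine ⟨hbσ.strip.mem_of_upperBound hbS hbu, Band.isClosed_fiber hbσ.strip.isClosed b,
          σ.ordConnected_fiber b, ?_⟩
        rintro p ⟨hp1, hp2⟩
        have hp1 : p.1 = b := hp1
        have hp2 : (b, p.2) ∈ σ.carrier := hp2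
        rw [← hp1] at hp2
        exact hbσ.subset hp2
      · exact h𝒱 v hv
    have hU' : σ.carrier ∪ R = bandUnion (𝒟 : Set Band) (𝒱 : Set (ℝ × Set ℝ)) := by
      rw [← hU]
      ext p
      constructor
      · rintro (h | h)
        · exact Or.inl h
        · rcases (hRmem p).1 h with h | h
          exacts [Or.inl h.2, Or.inr h]
      · rintro (h | h)
        · exact Or.inl h
        · exact Or.inr ((hRmem p).2 (Or.inr h))
    have hI : σ.carrier ∩ R = {b} ×ˢ σ.fiber b := by
      ext p
      constructor
      · rintro ⟨hpσ, hpR⟩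
        have hpb : p.1 = b := by
          rcases (hRmem p).1 hpR with h | h
          · exact h.1
          · exact le_antisymm (hbu hpσ.1) (hright p hpσ h hbS)
        exact ⟨hpb, show (b, p.2) ∈ σ.carrier from hpb ▸ hpσ⟩
      · rintro ⟨hp1, hp2⟩
        have hp1 : p.1 = b := hp1
        have hp2 : (b, p.2) ∈ σ.carrier := hp2
        rw [← hp1] at hp2
        exact ⟨hp2, (hRmem p).2 (Or.inl ⟨hp1, hp2⟩)⟩
    have hRc : IsClosed R := isClosed_bandUnion h𝒟' hsegs (Finset.finite_toSet _)
      (Finset.finite_toSet _)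
    have hfne := hbσ.nonempty_fiber hbS
    have hRne : R.Nonempty := by
      obtain ⟨y, hy⟩ := hfne
      exact ⟨(b, y), (hRmem _).2 (Or.inl ⟨rfl, hy⟩)⟩
    rw [← hU'] at hconn ⊢
    have hRconn : IsConnected R := ⟨hRne, IsPreconnected.left_of_union hRc hbσ.isClosed
      (by rw [union_comm]; exact hconn.isPreconnected)
      (by
        rw [inter_comm, hI]
        exact isPreconnected_singleton.prod (σ.ordConnected_fiber b).isPreconnected)⟩
    refine hbσ.isExtensor.union (ih _ _ (Finset.card_erase_lt_of_mem hσ) h𝒟' hsegs hRconn)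
      hbσ.isClosed hRc ?_
    rw [hI]
    exact (isExtensor_singleton _).prod (isExtensor_ordConnected (σ.ordConnected_fiber b) hfne)
  · have hemp : bandUnion ((𝒟.erase σ : Finset _) : Set Band) (𝒱 : Set (ℝ × Set ℝ)) = ∅ := by
      rw [← not_nonempty_iff_eq_empty]
      intro hRne
      obtain ⟨p, hpσ, hpR⟩ := inter_nonempty_of_isPreconnected_union hbσ.isClosed
        (isClosed_bandUnion h𝒟' h𝒱 (Finset.finite_toSet _) 𝒱.finite_toSet)
        (hU.symm ▸ hconn.isPreconnected) hσne hRne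
      exact hb ⟨p.1, hpσ.1, hright p hpσ hpR⟩
    rw [← hU, hemp, union_empty]
    exact hbσ.isExtensor

end Gluing

/-! ### Intervals cut out by finitely many points. -/

/-- The closed interval around `t₀` cut out of the line by the points of `P`. -/
def cutInterval (P : Set ℝ) (t₀ : ℝ) : Set ℝ :=
  {t | ∀ b ∈ P, (b < t₀ → b ≤ t) ∧ (t₀ < b → t ≤ b)}

section cutInterval

variable {P : Set ℝ} {t₀ : ℝ}

theorem mem_cutInterval_self : t₀ ∈ cutInterval P t₀ := fun _ _ => ⟨le_of_lt, le_of_lt⟩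

theorem cutInterval_sdiff (h₀ : t₀ ∉ P) :
    cutInterval P t₀ \ P = {t | ∀ b ∈ P, (b < t₀ → b < t) ∧ (t₀ < b → t < b)} := by
  ext t
  constructor
  · rintro ⟨ht, htP⟩ b hb
    exact ⟨fun h => lt_of_le_of_ne ((ht b hb).1 h) (by rintro rfl; exact htP hb),
      fun h => lt_of_le_of_ne ((ht b hb).2 h) (by rintro rfl; exact htP hb)⟩
  · intro ht
    refine ⟨fun b hb => ⟨fun h => ((ht b hb).1 h).le, fun h => ((ht b hb).2 h).le⟩, fun htP => ?_⟩
    rcases lt_trichotomy t t₀ with h | h | h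
    · exact lt_irrefl _ ((ht t htP).1 h)
    · exact h₀ (h ▸ htP)
    · exact lt_irrefl _ ((ht t htP).2 h)

theorem isStrip_cutInterval (hP : P.Finite) (h₀ : t₀ ∉ P) : IsStrip P (cutInterval P t₀) := by
  have hd := cutInterval_sdiff h₀
  refine ⟨?_, ⟨?_⟩, ⟨t₀, mem_cutInterval_self, h₀⟩, ⟨?_⟩, ?_, ?_⟩
  · have : cutInterval P t₀ = ⋂ b ∈ P, {t | (b < t₀ → b ≤ t) ∧ (t₀ < b → t ≤ b)} := by
      ext t
      simp [cutInterval]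
    rw [this]
    refine isClosed_biInter fun b _ => IsClosed.and ?_ ?_
    · by_cases h : b < t₀
      · simp only [h, true_imp_iff]; exact isClosed_Ici
      · simp [h]
    · by_cases h : t₀ < b
      · simp only [h, true_imp_iff]; exact isClosed_Iic
      · simp [h]
  · intro x hx y hy z hz b hb
    exact ⟨fun h => ((hx b hb).1 h).trans hz.1, fun h => hz.2.trans ((hy b hb).2 h)⟩
  · rw [hd]
    intro x hx y hy z hz b hb
    exact ⟨fun h => ((hx b hb).1 h).trans_le hz.1, fun h => hz.2.trans_lt ((hy b hb).2 h)⟩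
  · intro t ht
    have hc : Continuous fun e : ℝ => t₀ + e * (t - t₀) := by fun_prop
    have h1 : (1 : ℝ) ∈ closure (Ico 0 1) := by
      rw [closure_Ico zero_ne_one]
      exact ⟨zero_le_one, le_rfl⟩
    have := map_mem_closure hc h1 (t := cutInterval P t₀ \ P) (fun e he => by
      rw [hd]
      intro b hb
      refine ⟨fun h => ?_, fun h => ?_⟩
      · have := (ht b hb).1 h
        rcases le_total t₀ t with h' | h'
        · nlinarith [he.1, he.2]
        · nlinarith [he.1, he.2]
      · have := (ht b hb).2 h
        rcases le_total t₀ t with h' | h'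
        · nlinarith [he.1, he.2]
        · nlinarith [he.1, he.2])
    simpa using this
  · have : cutInterval P t₀ \ P =
        ⋂ b ∈ P, {t | (b < t₀ → b < t) ∧ (t₀ < b → t < b)} := by
      rw [hd]
      ext t
      simp
    rw [this]
    refine hP.isOpen_biInter fun b _ => IsOpen.and ?_ ?_
    · by_cases h : b < t₀
      · simp only [h, true_imp_iff]; exact isOpen_Ioi
      · simp [h]
    · by_cases h : t₀ < b
      · simp only [h, true_imp_iff]; exact isOpen_Iio
      · simp [h]

theorem subset_cutInterval {A : Set ℝ} (hA : IsPreconnected A) (hAP : ∀ t ∈ A, t ∉ P) {a : ℝ}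
    (ha : a ∈ A) (haS : a ∈ cutInterval P t₀) : A ⊆ cutInterval P t₀ := by
  intro t ht b hb
  refine ⟨fun h => ?_, fun h => ?_⟩
  · by_contra! hlt
    exact hAP b (hA.ordConnected.out ht ha ⟨hlt.le, (haS b hb).1 h⟩) hb
  · by_contra! hlt
    exact hAP b (hA.ordConnected.out ha ht ⟨(haS b hb).2 h, hlt.le⟩) hb

theorem cutInterval_eq {t : ℝ} (h₀ : t₀ ∉ P) (ht : t ∈ cutInterval P t₀) (htP : t ∉ P) :
    cutInterval P t = cutInterval P t₀ := by
  have h1 : t ∈ cutInterval P t₀ \ P := ⟨ht, htP⟩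
  rw [cutInterval_sdiff h₀] at h1
  have key : ∀ b ∈ P, (b < t ↔ b < t₀) ∧ (t < b ↔ t₀ < b) := by
    intro b hb
    have hb0 : b ≠ t₀ := by rintro rfl; exact h₀ hb
    obtain ⟨h2, h3⟩ := h1 b hb
    rcases lt_or_gt_of_ne hb0 with h | h
    · have := h2 h
      exact ⟨iff_of_true this h, iff_of_false this.not_gt h.not_gt⟩
    · have := h3 h
      exact ⟨iff_of_false this.not_gt h.not_gt, iff_of_true this h⟩
  ext s
  constructor
  · intro hs b hb
    rw [← (key b hb).1, ← (key b hb).2]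
    exact hs b hb
  · intro hs b hb
    rw [(key b hb).1, (key b hb).2]
    exact hs b hb

/-- The interval depends only on which points of `P` lie to the left of `t₀`, and `P` has finitely
many subsets. -/
theorem finite_cutIntervals (hP : P.Finite) : (cutInterval P '' Pᶜ).Finite := by
  refine (hP.finite_subsets.image
    fun L => {t | ∀ b ∈ P, (b ∈ L → b ≤ t) ∧ (b ∉ L → t ≤ b)}).subset ?_
  rintro _ ⟨t₀, h₀, rfl⟩
  refine ⟨P ∩ Iio t₀, inter_subset_left, ?_⟩
  ext t
  have key : ∀ b ∈ P, (b ∈ P ∩ Iio t₀ ↔ b < t₀) ∧ (b ∉ P ∩ Iio t₀ ↔ t₀ < b) := by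
    intro b hb
    have hb0 : b ≠ t₀ := by rintro rfl; exact h₀ hb
    simp only [mem_inter_iff, hb, true_and, mem_Iio, not_lt, iff_self]
    exact ⟨fun h => lt_of_le_of_ne h hb0.symm, le_of_lt⟩
  exact ⟨fun ht b hb => ⟨fun h => (ht b hb).1 ((key b hb).1.2 h),
    fun h => (ht b hb).2 ((key b hb).2.2 h)⟩, fun ht b hb => ⟨fun h => (ht b hb).1
    ((key b hb).1.1 h), fun h => (ht b hb).2 ((key b hb).2.1 h)⟩⟩

end cutInterval

/-! ### Rotated frames and polynomial curves. -/

/-- The point with coordinates `s`, `y` in the frame rotated by `θ`. -/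
noncomputable def framePoint (θ s y : ℝ) : ℝ × ℝ :=
  (Real.cos θ * s - Real.sin θ * y, Real.sin θ * s + Real.cos θ * y)

theorem frameX_framePoint (θ s y : ℝ) : frameX θ (framePoint θ s y) = s := by
  simp only [frameX, framePoint]
  linear_combination s * Real.cos_sq_add_sin_sq θ

theorem frameY_framePoint (θ s y : ℝ) : frameY θ (framePoint θ s y) = y := by
  simp only [frameY, framePoint]
  linear_combination y * Real.cos_sq_add_sin_sq θ

theorem framePoint_frame (θ : ℝ) (p : ℝ × ℝ) : framePoint θ (frameX θ p) (frameY θ p) = p := by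
  refine Prod.ext ?_ ?_
  · simp only [frameX, frameY, framePoint]
    linear_combination p.1 * Real.cos_sq_add_sin_sq θ
  · simp only [frameX, frameY, framePoint]
    linear_combination p.2 * Real.cos_sq_add_sin_sq θ

@[fun_prop] theorem continuous_frameX (θ : ℝ) : Continuous (frameX θ) := by
  unfold frameX; fun_prop

@[fun_prop] theorem continuous_frameY (θ : ℝ) : Continuous (frameY θ) := by
  unfold frameY; fun_prop

theorem continuous_framePoint (θ : ℝ) : Continuous fun q : ℝ × ℝ => framePoint θ q.1 q.2 := by
  unfold framePoint; fun_prop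

/-- Parametrization of the graph of `f` in the frame rotated by `θ`. -/
noncomputable def polyCurve (f : Polynomial ℝ) (θ t : ℝ) : ℝ × ℝ := framePoint θ t (f.eval t)

/-- The defining function of the polynomial half plane. -/
noncomputable def polyLevel (f : Polynomial ℝ) (θ : ℝ) (p : ℝ × ℝ) : ℝ :=
  f.eval (frameX θ p) - frameY θ p

theorem continuous_polyLevel (f : Polynomial ℝ) (θ : ℝ) : Continuous (polyLevel f θ) := by
  unfold polyLevel; fun_prop

theorem continuous_polyCurve (f : Polynomial ℝ) (θ : ℝ) : Continuous (polyCurve f θ) :=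
  (continuous_framePoint θ).comp (continuous_id.prodMk f.continuous)

theorem polyLevel_framePoint (f : Polynomial ℝ) (θ s y : ℝ) :
    polyLevel f θ (framePoint θ s y) = f.eval s - y := by
  rw [polyLevel, frameX_framePoint, frameY_framePoint]

theorem polyLevel_polyCurve (f : Polynomial ℝ) (θ t : ℝ) :
    polyLevel f θ (polyCurve f θ t) = 0 := by
  rw [polyCurve, polyLevel_framePoint, sub_self]

theorem polyCurve_frameX {f : Polynomial ℝ} {θ : ℝ} {p : ℝ × ℝ} (h : polyLevel f θ p = 0) :
    polyCurve f θ (frameX θ p) = p := by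
  rw [polyCurve, sub_eq_zero.1 h, framePoint_frame]

theorem polyCurve_injective (f : Polynomial ℝ) (θ : ℝ) : Function.Injective (polyCurve f θ) := by
  intro s t h
  have := congrArg (frameX θ) h
  rwa [polyCurve, polyCurve, frameX_framePoint, frameX_framePoint] at this

open Polynomial in
/-- First coordinate of the curve, as a polynomial. -/
noncomputable def curveFst (f : ℝ[X]) (θ : ℝ) : ℝ[X] := C (Real.cos θ) * X - C (Real.sin θ) * f

open Polynomial in
/-- Second coordinate of the curve, as a polynomial. -/
noncomputable def curveSnd (f : ℝ[X]) (θ : ℝ) : ℝ[X] := C (Real.sin θ) * X + C (Real.cos θ) * f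

theorem eval_curveFst (f : Polynomial ℝ) (θ t : ℝ) :
    (curveFst f θ).eval t = (polyCurve f θ t).1 := by
  simp [curveFst, polyCurve, framePoint]

theorem eval_curveSnd (f : Polynomial ℝ) (θ t : ℝ) :
    (curveSnd f θ).eval t = (polyCurve f θ t).2 := by
  simp [curveSnd, polyCurve, framePoint]

open Polynomial in
/-- The defining function of the second half plane along the first curve, as a polynomial. -/
noncomputable def crossing (f : ℝ[X]) (θ : ℝ) (g : ℝ[X]) (φ : ℝ) : ℝ[X] :=
  g.comp (C (Real.cos φ) * curveFst f θ + C (Real.sin φ) * curveSnd f θ) -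
    (-C (Real.sin φ) * curveFst f θ + C (Real.cos φ) * curveSnd f θ)

theorem eval_crossing (f : Polynomial ℝ) (θ : ℝ) (g : Polynomial ℝ) (φ t : ℝ) :
    (crossing f θ g φ).eval t = polyLevel g φ (polyCurve f θ t) := by
  simp [crossing, polyLevel, frameX, frameY, eval_curveFst, eval_curveSnd]

/-- If the first curve lies on the second, its points have infinitely many distinct parameters on
the second curve. At each of these the crossing polynomial in the other order vanishes. -/
theorem crossing_eq_zero_symm {f g : Polynomial ℝ} {θ φ : ℝ} (h : crossing f θ g φ = 0) :
    crossing g φ f θ = 0 := by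
  have h0 : ∀ t, polyCurve g φ (frameX φ (polyCurve f θ t)) = polyCurve f θ t := fun t =>
    polyCurve_frameX (by rw [← eval_crossing, h, Polynomial.eval_zero])
  refine Polynomial.eq_zero_of_infinite_isRoot _
    ((infinite_range_of_injective (f := fun t => frameX φ (polyCurve f θ t)) ?_).mono ?_)
  · intro s t hst
    refine polyCurve_injective f θ ?_
    rw [← h0 s, ← h0 t]
    exact congrArg _ hst
  · rintro _ ⟨t, rfl⟩
    change Polynomial.eval _ _ = 0
    rw [eval_crossing, h0, polyLevel_polyCurve]

/-! ### The region, its components and its regularity. -/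

section Region

variable {ι : Type*} {f : ι → Polynomial ℝ} {β : ι → ℝ}

/-- The intersection of a family of open polynomial half planes. -/
def polyRegion (f : ι → Polynomial ℝ) (β : ι → ℝ) : Set (ℝ × ℝ) :=
  ⋂ i, openPolyHalfPlane (f i) (β i)

theorem mem_polyRegion {p : ℝ × ℝ} : p ∈ polyRegion f β ↔ ∀ i, 0 < polyLevel (f i) (β i) p := by
  simp [polyRegion, openPolyHalfPlane, polyLevel]

theorem polyCurve_not_mem (i : ι) (t : ℝ) : polyCurve (f i) (β i) t ∉ polyRegion f β := fun h =>
  (mem_polyRegion.1 h i).ne' (polyLevel_polyCurve _ _ _)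

theorem isOpen_polyRegion [Finite ι] : IsOpen (polyRegion f β) :=
  isOpen_iInter_of_finite fun i => isOpen_lt continuous_const (continuous_polyLevel (f i) (β i))

theorem polyLevel_nonneg {p : ℝ × ℝ} (hp : p ∈ closure (polyRegion f β)) (i : ι) :
    0 ≤ polyLevel (f i) (β i) p :=
  closure_minimal (fun _ hq => (mem_polyRegion.1 hq i).le)
    (isClosed_le continuous_const (continuous_polyLevel _ _)) hp

theorem polyLevel_add_smul (f : Polynomial ℝ) (θ : ℝ) (p : ℝ × ℝ) (t : ℝ) :
    polyLevel f θ (p.1 - t * Real.sin θ, p.2 + t * Real.cos θ) = polyLevel f θ p - t := by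
  have h1 : frameX θ (p.1 - t * Real.sin θ, p.2 + t * Real.cos θ) = frameX θ p := by
    simp only [frameX]; ring
  have h2 : frameY θ (p.1 - t * Real.sin θ, p.2 + t * Real.cos θ) = frameY θ p + t := by
    simp only [frameY]
    linear_combination t * Real.cos_sq_add_sin_sq θ
  rw [polyLevel, h1, h2, polyLevel]
  ring

theorem not_mem_closure_polyRegion {p : ℝ × ℝ} {i : ι} (hp : polyLevel (f i) (β i) p ≤ 0) {t : ℝ}
    (ht : 0 < t) :
    (p.1 - t * Real.sin (β i), p.2 + t * Real.cos (β i)) ∉ closure (polyRegion f β) := fun h => by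
  have := polyLevel_nonneg h i
  rw [polyLevel_add_smul] at this
  linarith

/-- At a point with a nonpositive level, the upward direction of the corresponding frame leaves the
closure at once. -/
theorem interior_closure_polyRegion [Finite ι] :
    interior (closure (polyRegion f β)) = polyRegion f β := by
  refine Subset.antisymm (fun p hp => mem_polyRegion.2 fun i => ?_)
    (interior_maximal subset_closure isOpen_polyRegion)
  by_contra! hle
  have hc : Continuous fun t : ℝ => (p.1 - t * Real.sin (β i), p.2 + t * Real.cos (β i)) := by
    fun_prop
  have hev : ∀ᶠ t in 𝓝 (0 : ℝ), (p.1 - t * Real.sin (β i), p.2 + t * Real.cos (β i)) ∈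
      interior (closure (polyRegion f β)) :=
    hc.continuousAt.eventually (isOpen_interior.mem_nhds (by simpa using hp))
  obtain ⟨t, ht, ht0⟩ :=
    ((hev.filter_mono nhdsWithin_le_nhds).and (self_mem_nhdsWithin (s := Ioi 0))).exists
  exact not_mem_closure_polyRegion hle ht0 (interior_subset ht)

end Region

section Component

variable {R : Set (ℝ × ℝ)} {x₀ : ℝ × ℝ}

theorem subset_connectedComponentIn_of_meets {A : Set (ℝ × ℝ)} (hA : IsPreconnected A)
    (hAR : A ⊆ R) (hne : (A ∩ connectedComponentIn R x₀).Nonempty) :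
    A ⊆ connectedComponentIn R x₀ := by
  obtain ⟨a, ha, ha'⟩ := hne
  rw [connectedComponentIn_eq ha']
  exact hA.subset_connectedComponentIn ha hAR

/-- The component of a limit point lying in `R` is open, so it meets the given component and equals
it. -/
theorem closure_connectedComponentIn_inter (hR : IsOpen R) :
    closure (connectedComponentIn R x₀) ∩ R ⊆ connectedComponentIn R x₀ := by
  rintro y ⟨hy, hyR⟩
  obtain ⟨z, hz, hz'⟩ := mem_closure_iff.1 hy _ hR.connectedComponentIn
    (mem_connectedComponentIn hyR)
  exact subset_connectedComponentIn_of_meets isPreconnected_connectedComponentIn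
    (connectedComponentIn_subset R y) ⟨z, hz, hz'⟩ (mem_connectedComponentIn hyR)

theorem interior_closure_connectedComponentIn (hR : IsOpen R)
    (hreg : interior (closure R) ⊆ R) :
    interior (closure (connectedComponentIn R x₀)) = connectedComponentIn R x₀ := by
  refine Subset.antisymm (fun y hy => ?_)
    (interior_maximal subset_closure hR.connectedComponentIn)
  exact closure_connectedComponentIn_inter hR ⟨interior_subset hy,
    hreg (interior_mono (closure_mono (connectedComponentIn_subset R x₀)) hy)⟩

theorem frontier_closure_connectedComponentIn (hR : IsOpen R)
    (hreg : interior (closure R) ⊆ R) :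
    frontier (closure (connectedComponentIn R x₀)) =
      closure (connectedComponentIn R x₀) \ R := by
  rw [frontier, closure_closure, interior_closure_connectedComponentIn hR hreg]
  ext y
  exact ⟨fun h => ⟨h.1, fun hR' => h.2 (closure_connectedComponentIn_inter hR ⟨h.1, hR'⟩)⟩,
    fun h => ⟨h.1, fun hC => h.2 (connectedComponentIn_subset R x₀ hC)⟩⟩

end Component

/-- A ball is homeomorphic to the whole space, where the complement of a countable set is connected
in dimension at least 2. -/
theorem isPreconnected_ball_sdiff_finite {E : Type*} [NormedAddCommGroup E] [NormedSpace ℝ E]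
    (hE : 1 < Module.rank ℝ E) (x : E) {r : ℝ} (hr : 0 < r) {P : Set E} (hP : P.Finite) :
    IsPreconnected (Metric.ball x r \ P) := by
  set e := OpenPartialHomeomorph.univBall x r
  have hinj : Function.Injective e := fun a b h =>
    e.injOn (by simp [e]) (by simp [e]) h
  have : Metric.ball x r \ P = e '' (e ⁻¹' P)ᶜ := by
    rw [← OpenPartialHomeomorph.univBall_target x hr]
    ext y
    constructor
    · rintro ⟨hy, hyP⟩
      exact ⟨e.symm y, by rwa [mem_compl_iff, mem_preimage, e.right_inv hy], e.right_inv hy⟩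
    · rintro ⟨z, hz, rfl⟩
      exact ⟨e.map_source (by simp [e]), hz⟩
  rw [this]
  exact ((hP.preimage hinj.injOn).countable.isConnected_compl_of_one_lt_rank
    hE).isPreconnected.image _ (OpenPartialHomeomorph.continuous_univBall x r).continuousOn

/-- Allows crossings to be ignored. If near `p` the frontier lay in `P`, a ball minus `P`, being
connected, would lie in the interior of `closure C` or in its complement. The first puts `p` in the
interior; the second contradicts that the open set `C` accumulates at `p`. -/
theorem frontier_subset_closure_sdiff {C : Set (ℝ × ℝ)} (hC : IsOpen C) {P : Set (ℝ × ℝ)}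
    (hP : P.Finite) : frontier (closure C) ⊆ closure (frontier (closure C) \ P) := by
  intro p hp
  by_contra hcon
  obtain ⟨r, hr, hball⟩ := Metric.isOpen_iff.1 isClosed_closure.isOpen_compl p hcon
  have hrank : 1 < Module.rank ℝ (ℝ × ℝ) := by
    rw [← Module.finrank_eq_rank ℝ (ℝ × ℝ), Module.finrank_prod, Module.finrank_self]
    norm_num
  have hdense : Dense Pᶜ := hP.countable.dense_compl ℝ
  have hW : Metric.ball p r \ P ⊆ interior (closure C) ∪ (closure C)ᶜ := by
    intro y hy
    by_cases hyT : y ∈ closure C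
    · left
      by_contra hyi
      refine hball hy.1 (subset_closure ⟨?_, hy.2⟩)
      rw [frontier, closure_closure]
      exact ⟨hyT, hyi⟩
    · exact Or.inr hyT
  rcases (isPreconnected_ball_sdiff_finite hrank p hr hP).subset_or_subset isOpen_interior
    isClosed_closure.isOpen_compl (disjoint_compl_right.mono_left interior_subset) hW with h | h
  · have h1 : Metric.ball p r ⊆ closure C :=
      (hdense.open_subset_closure_inter Metric.isOpen_ball).trans
        (closure_minimal (h.trans interior_subset) isClosed_closure)
    exact hp.2 (mem_interior.2 ⟨_, h1, Metric.isOpen_ball, Metric.mem_ball_self hr⟩)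
  · have hpC : p ∈ closure C := by
      have := hp.1
      rwa [closure_closure] at this
    obtain ⟨y, hy, hyC⟩ := mem_closure_iff.1 hpC _ Metric.isOpen_ball (Metric.mem_ball_self hr)
    obtain ⟨z, hz, hzP⟩ := hdense.inter_open_nonempty _ (Metric.isOpen_ball.inter hC) ⟨y, hy, hyC⟩
    exact h ⟨hz.1, hzP⟩ (subset_closure hz.2)

/-! ### The frontier of a component as a finite union of sides. -/

section Frontier

variable {ι : Type*} [Finite ι] {f : ι → Polynomial ℝ} {β : ι → ℝ} {x₀ : ℝ × ℝ}

/-- Parameters at which the `i`-th curve meets another, different, curve. -/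
def crossingSet (f : ι → Polynomial ℝ) (β : ι → ℝ) (i : ι) : Set ℝ :=
  {t | ∃ j, crossing (f i) (β i) (f j) (β j) ≠ 0 ∧
    (crossing (f i) (β i) (f j) (β j)).eval t = 0}

theorem finite_crossingSet (i : ι) : (crossingSet f β i).Finite := by
  have : crossingSet f β i = ⋃ j, {t | crossing (f i) (β i) (f j) (β j) ≠ 0 ∧
      (crossing (f i) (β i) (f j) (β j)).eval t = 0} := by
    ext t
    simp [crossingSet]
  rw [this]
  refine finite_iUnion fun j => ?_
  by_cases h : crossing (f i) (β i) (f j) (β j) = 0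
  · simp [h]
  · exact (Polynomial.finite_setOfPred_isRoot h).subset fun t ht => ht.2

theorem frontier_component (f : ι → Polynomial ℝ) (β : ι → ℝ) (x₀ : ℝ × ℝ) :
    frontier (closure (connectedComponentIn (polyRegion f β) x₀)) =
      closure (connectedComponentIn (polyRegion f β) x₀) \ polyRegion f β :=
  frontier_closure_connectedComponentIn isOpen_polyRegion interior_closure_polyRegion.subset

/-- Away from crossings, being a frontier point of a component is an open condition along a
boundary curve. -/
theorem eventually_mem_frontier {i : ι} {t : ℝ} (ht : t ∉ crossingSet f β i)
    (hF : polyCurve (f i) (β i) t ∈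
      frontier (closure (connectedComponentIn (polyRegion f β) x₀))) :
    ∀ᶠ s in 𝓝 t, polyCurve (f i) (β i) s ∈
      frontier (closure (connectedComponentIn (polyRegion f β) x₀)) := by
  set C := connectedComponentIn (polyRegion f β) x₀ with hC
  have hCR : C ⊆ polyRegion f β := connectedComponentIn_subset _ _
  rw [frontier_component] at hF ⊢
  set p := polyCurve (f i) (β i) t with hp
  -- Straightening coordinates: the second coordinate is the level of the `i`-th half plane, so the
  -- curve becomes the axis and its positive side the upper half plane.
  set Φ : ℝ × ℝ → ℝ × ℝ := fun q => framePoint (β i) q.1 ((f i).eval q.1 - q.2) with hΦ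
  have hΦc : Continuous Φ := (continuous_framePoint (β i)).comp
    (continuous_fst.prodMk (((f i).continuous.comp continuous_fst).sub continuous_snd))
  have hΦ0 : ∀ s, Φ (s, 0) = polyCurve (f i) (β i) s := fun s => by simp [hΦ, polyCurve]
  have hlev : ∀ q, polyLevel (f i) (β i) (Φ q) = q.2 := fun q => by
    rw [hΦ, polyLevel_framePoint]; ring
  have hpos : ∀ j, crossing (f i) (β i) (f j) (β j) ≠ 0 → 0 < polyLevel (f j) (β j) (Φ (t, 0)) := by
    intro j hj
    rw [hΦ0]
    refine lt_of_le_of_ne (polyLevel_nonneg (closure_mono hCR hF.1) j) fun h0 => ht ⟨j, hj, ?_⟩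
    rw [eval_crossing]
    exact h0.symm
  have hev : ∀ᶠ q in 𝓝 (t, (0 : ℝ)), ∀ j, crossing (f i) (β i) (f j) (β j) ≠ 0 →
      0 < polyLevel (f j) (β j) (Φ q) := by
    rw [eventually_all]
    intro j
    by_cases hj : crossing (f i) (β i) (f j) (β j) = 0
    · simp [hj]
    · filter_upwards [((continuous_polyLevel (f j) (β j)).comp hΦc).continuousAt.eventually
        (lt_mem_nhds (hpos j hj))] with q hq _ using hq
  obtain ⟨ε, hε, hball⟩ := Metric.eventually_nhds_iff_ball.1 hev
  set N : Set (ℝ × ℝ) := Metric.ball (t, 0) ε ∩ {q | 0 < q.2} with hN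
  have hNpre : IsPreconnected (Φ '' N) := by
    refine IsPreconnected.image (Convex.isPreconnected ?_) _ hΦc.continuousOn
    exact (convex_ball _ _).inter (convex_halfSpace_gt (IsLinearMap.mk (fun _ _ => rfl)
      fun _ _ => rfl) 0)
  set Ψ : ℝ × ℝ → ℝ × ℝ := fun x => (frameX (β i) x, polyLevel (f i) (β i) x) with hΨ
  have hΨc : Continuous Ψ := (continuous_frameX _).prodMk (continuous_polyLevel _ _)
  have hΦΨ : ∀ x, Φ (Ψ x) = x := fun x => by
    simp only [hΦ, hΨ, polyLevel, sub_sub_cancel]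
    exact framePoint_frame _ _
  have hΨp : Ψ p = (t, 0) := by
    rw [hΨ, hp]
    simp only [polyLevel_polyCurve]
    rw [polyCurve, frameX_framePoint]
  obtain ⟨c, hc, hcC⟩ := mem_closure_iff.1 hF.1 _ (Metric.isOpen_ball.preimage hΨc)
    (show p ∈ Ψ ⁻¹' Metric.ball (t, 0) ε by
      rw [mem_preimage, hΨp]; exact Metric.mem_ball_self hε)
  have hcN : c ∈ Φ '' N := ⟨Ψ c, ⟨hc, mem_polyRegion.1 (hCR hcC) i⟩, hΦΨ c⟩
  -- On the half ball, curves other than the `i`-th are controlled by continuity. If the `j`-th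
  -- curve coincides with the `i`-th, a zero of its level would lie on the axis, off the open half
  -- ball.
  have hNR : Φ '' N ⊆ polyRegion f β := by
    rintro x hx
    refine mem_polyRegion.2 fun j => ?_
    by_cases hj : crossing (f i) (β i) (f j) (β j) = 0
    · by_contra! hle
      obtain ⟨y, ⟨q, hq, rfl⟩, hy0⟩ := hNpre.intermediate_value hx hcN
        (continuous_polyLevel (f j) (β j)).continuousOn ⟨hle, (mem_polyRegion.1 (hCR hcC) j).le⟩
      have h1 := eval_crossing (f j) (β j) (f i) (β i) (frameX (β j) (Φ q))
      rw [crossing_eq_zero_symm hj, Polynomial.eval_zero, polyCurve_frameX hy0, hlev] at h1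
      exact hq.2.ne h1
    · obtain ⟨q, hq, rfl⟩ := hx
      exact hball q hq.1 j hj
  have hNC : Φ '' N ⊆ C := subset_connectedComponentIn_of_meets hNpre hNR ⟨c, hcN, hcC⟩
  filter_upwards [Metric.ball_mem_nhds t hε] with s hs
  refine ⟨?_, polyCurve_not_mem i s⟩
  have h0 : (0 : ℝ) ∈ closure (Ioo 0 ε) := by
    rw [closure_Ioo hε.ne]
    exact ⟨le_rfl, hε.le⟩
  have := map_mem_closure (hΦc.comp (continuous_const.prodMk continuous_id :
    Continuous fun v : ℝ => (s, v))) h0 (t := C) fun v hv => hNC ⟨(s, v), ⟨?_, hv.1⟩, rfl⟩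
  · rwa [Function.comp_apply, hΦ0] at this
  · rw [← ball_prod_same]
    refine ⟨hs, ?_⟩
    rw [Metric.mem_ball, Real.dist_eq, sub_zero, abs_of_pos hv.1]
    exact hv.2

theorem isSide_image_cutInterval (f : Polynomial ℝ) (θ : ℝ) {P : Set ℝ} (hP : P.Finite) {t : ℝ}
    (ht : t ∉ P) : IsSide (polyCurve f θ '' cutInterval P t) := by
  have hS := isStrip_cutInterval hP ht
  refine ⟨f, θ, cutInterval P t, hS.isClosed, hS.ordConnected,
    ((infinite_of_mem_nhds t (hS.isOpen_diff.mem_nhds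
      ⟨mem_cutInterval_self, ht⟩)).nontrivial).mono sdiff_subset, ?_⟩
  ext p
  constructor
  · rintro ⟨s, hs, rfl⟩
    change frameX θ _ ∈ _ ∧ frameY θ _ = _
    rw [polyCurve, frameX_framePoint, frameY_framePoint]
    exact ⟨hs, rfl⟩
  · rintro ⟨h1, h2⟩
    exact ⟨_, h1, by rw [polyCurve, ← h2, framePoint_frame]⟩

theorem isClosed_isSide {S : Set (ℝ × ℝ)} (hS : IsSide S) : IsClosed S := by
  obtain ⟨f, θ, J, hJ, -, -, rfl⟩ := hS
  exact (hJ.preimage (continuous_frameX θ)).inter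
    (isClosed_eq (continuous_frameY θ) (f.continuous.comp (continuous_frameX θ)))

/-- The frontier of the closure of a component is a finite union of sides. -/
theorem frontier_component_eq_sUnion (f : ι → Polynomial ℝ) (β : ι → ℝ) (x₀ : ℝ × ℝ) :
    ∃ 𝒮 : Set (Set (ℝ × ℝ)), 𝒮.Finite ∧ (∀ S ∈ 𝒮, IsSide S) ∧
      frontier (closure (connectedComponentIn (polyRegion f β) x₀)) = ⋃₀ 𝒮 := by
  set C := connectedComponentIn (polyRegion f β) x₀ with hC
  set F := frontier (closure C) with hF
  -- All pieces of the curves between consecutive crossings that lie entirely in the frontier.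
  set 𝒮 : Set (Set (ℝ × ℝ)) := (⋃ i, (fun J => polyCurve (f i) (β i) '' J) ''
    (cutInterval (crossingSet f β i) '' (crossingSet f β i)ᶜ)) ∩ {S | S ⊆ F} with h𝒮
  have h𝒮f : 𝒮.Finite := (finite_iUnion fun i =>
    (finite_cutIntervals (finite_crossingSet i)).image _).subset inter_subset_left
  have h𝒮s : ∀ S ∈ 𝒮, IsSide S := by
    rintro S ⟨hS, -⟩
    obtain ⟨i, _, ⟨t, ht, rfl⟩, rfl⟩ := mem_iUnion.1 hS
    exact isSide_image_cutInterval _ _ (finite_crossingSet i) ht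
  refine ⟨𝒮, h𝒮f, h𝒮s, Subset.antisymm ?_ (sUnion_subset fun S hS => hS.2)⟩
  have hPf : (⋃ i, polyCurve (f i) (β i) '' crossingSet f β i).Finite :=
    finite_iUnion fun i => (finite_crossingSet i).image _
  refine (frontier_subset_closure_sdiff isOpen_polyRegion.connectedComponentIn hPf).trans
    (closure_minimal ?_ (sUnion_eq_biUnion ▸ h𝒮f.isClosed_biUnion fun S hS =>
      isClosed_isSide (h𝒮s S hS)))
  rintro p ⟨hp, hpP⟩
  have hpF : p ∈ F := hp
  rw [frontier_component] at hp
  obtain ⟨i, hi⟩ : ∃ i, polyLevel (f i) (β i) p = 0 := by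
    by_contra! hne
    exact hp.2 (mem_polyRegion.2 fun i => lt_of_le_of_ne
      (polyLevel_nonneg (closure_mono (connectedComponentIn_subset _ _) hp.1) i) (hne i).symm)
  set t := frameX (β i) p with ht
  have hpt : polyCurve (f i) (β i) t = p := polyCurve_frameX hi
  have htQ : t ∉ crossingSet f β i := fun h => hpP (mem_iUnion.2 ⟨i, t, h, hpt⟩)
  have hS := isStrip_cutInterval (finite_crossingSet i) htQ
  refine ⟨_, ⟨mem_iUnion.2 ⟨i, _, ⟨t, htQ, rfl⟩, rfl⟩, ?_⟩, t, mem_cutInterval_self, hpt⟩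
  have hFc : IsClosed (polyCurve (f i) (β i) ⁻¹' F) :=
    isClosed_frontier.preimage (continuous_polyCurve _ _)
  -- Frontier parameters are relatively open and closed in the connected open piece.
  have hsub : cutInterval (crossingSet f β i) t \ crossingSet f β i ⊆
      (cutInterval (crossingSet f β i) t \ crossingSet f β i) ∩ polyCurve (f i) (β i) ⁻¹' F := by
    refine hS.ordConnected_diff.isPreconnected.subset_of_closure_inter_subset ?_ ?_ ?_
    · rw [isOpen_iff_mem_nhds]
      rintro s ⟨hs, hsF⟩
      exact Filter.inter_mem (hS.isOpen_diff.mem_nhds hs) (eventually_mem_frontier hs.2 hsF)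
    · exact ⟨t, ⟨mem_cutInterval_self, htQ⟩, ⟨mem_cutInterval_self, htQ⟩,
        show polyCurve (f i) (β i) t ∈ F from hpt ▸ hpF⟩
    · rintro s ⟨hs, hs'⟩
      exact ⟨hs', hFc.closure_subset_iff.2 inter_subset_right hs⟩
  rintro _ ⟨s, hs, rfl⟩
  exact hFc.closure_subset_iff.2 (hsub.trans inter_subset_right) (hS.subset_closure hs)

end Frontier

/-! ### Branches of the curves over a strip. -/

/-- Over a strip containing no critical value, a polynomial has a continuous inverse on each
interval cut out by the preimages of the cutting points. -/
theorem exists_inverse_branch {p : Polynomial ℝ} (hp : 0 < p.degree) {B : Set ℝ} (hB : B.Finite)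
    (hcrit : ∀ t, p.derivative.eval t = 0 → p.eval t ∈ B) {t₀ : ℝ} (ht₀ : p.eval t₀ ∉ B) :
    InjOn p.eval (cutInterval (p.eval ⁻¹' B) t₀) ∧
      p.eval '' cutInterval (p.eval ⁻¹' B) t₀ = cutInterval B (p.eval t₀) ∧
      ∃ ψ : C(ℝ, ℝ), ∀ t ∈ cutInterval (p.eval ⁻¹' B) t₀, ψ (p.eval t) = t := by
  set P := p.eval ⁻¹' B with hP
  have hPf : P.Finite := by
    have : P = ⋃ b ∈ B, {t | (p - Polynomial.C b).IsRoot t} := by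
      ext t
      simp [hP, sub_eq_zero]
    rw [this]
    refine hB.biUnion fun b _ => Polynomial.finite_setOfPred_isRoot fun h => ?_
    rw [sub_eq_zero.1 h] at hp
    exact absurd Polynomial.degree_C_le (not_le.2 hp)
  have hJ := isStrip_cutInterval (t₀ := t₀) hPf ht₀
  have hS := isStrip_cutInterval hB ht₀
  set J := cutInterval P t₀ with hJdef
  have ht₀J : t₀ ∈ J \ P := ⟨mem_cutInterval_self, ht₀⟩
  have hsub' : p.eval '' (J \ P) ⊆ cutInterval B (p.eval t₀) :=
    subset_cutInterval (hJ.ordConnected_diff.isPreconnected.image _ p.continuous.continuousOn)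
      (by rintro _ ⟨t, ht, rfl⟩; exact ht.2) ⟨t₀, ht₀J, rfl⟩ mem_cutInterval_self
  have hsub : p.eval '' J ⊆ cutInterval B (p.eval t₀) := by
    rintro _ ⟨t, ht, rfl⟩
    exact (hS.isClosed.preimage p.continuous).closure_subset_iff.2 (image_subset_iff.1 hsub')
      (hJ.subset_closure ht)
  -- Rolle: two equal values would give a critical point strictly inside `J`, whereas parameters
  -- over `B` are ends of `J`.
  have hinj : InjOn p.eval J := by
    have aux : ∀ s ∈ J, ∀ t ∈ J, s < t → p.eval s ≠ p.eval t := by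
      intro s hs t ht hst heq
      obtain ⟨r, hr, hr0⟩ := exists_hasDerivAt_eq_zero hst p.continuous.continuousOn heq
        fun x _ => p.hasDerivAt x
      rcases hJ.bound_of_mem (hJ.ordConnected.out hs ht ⟨hr.1.le, hr.2.le⟩) (hcrit r hr0) with h | h
      · exact (h hs).not_gt hr.1
      · exact (h ht).not_gt hr.2
    intro s hs t ht heq
    rcases lt_trichotomy s t with h | h | h
    · exact absurd heq (aux s hs t ht h)
    · exact h
    · exact absurd heq.symm (aux t ht s hs h)
  have hcl : IsClosed (p.eval '' J) := p.isClosedMap_eval _ hJ.isClosed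
  have hop : IsOpen (p.eval '' (J \ P)) := by
    rw [isOpen_iff_mem_nhds]
    rintro _ ⟨t, ht, rfl⟩
    rw [← (p.hasStrictDerivAt t).map_nhds_eq fun h => ht.2 (hcrit t h)]
    exact image_mem_map (hJ.isOpen_diff.mem_nhds ht)
  -- The image is open by the inverse function theorem and relatively closed since polynomial maps
  -- are closed.
  have hsurj : cutInterval B (p.eval t₀) \ B ⊆ p.eval '' (J \ P) := by
    refine hS.ordConnected_diff.isPreconnected.subset_of_closure_inter_subset hop
      ⟨p.eval t₀, ⟨mem_cutInterval_self, ht₀⟩, t₀, ht₀J, rfl⟩ ?_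
    rintro x ⟨hx, -, hxB⟩
    obtain ⟨t, ht, rfl⟩ := hcl.closure_subset_iff.2 (image_mono sdiff_subset) hx
    exact ⟨t, ⟨ht, hxB⟩, rfl⟩
  refine ⟨hinj, Subset.antisymm hsub (hS.subset_closure.trans
    (hcl.closure_subset_iff.2 (hsurj.trans (image_mono sdiff_subset)))), ?_⟩
  -- The inverse lives on a closed set and extends to the line by Tietze.
  have hemb : IsClosedEmbedding fun t : J => p.eval (t : ℝ) :=
    IsClosedEmbedding.of_continuous_injective_isClosedMap
      (p.continuous.comp continuous_subtype_val) (fun s t h => Subtype.ext (hinj s.2 t.2 h))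
      (p.isClosedMap_eval.comp hJ.isClosed.isClosedMap_subtype_val)
  obtain ⟨ψ, hψ⟩ := (⟨Subtype.val, continuous_subtype_val⟩ : C(J, ℝ)).exists_extension' hemb
  exact ⟨ψ, fun t ht => congrFun hψ ⟨t, ht⟩⟩

section Sections

variable {ι : Type*} [Finite ι] {f : ι → Polynomial ℝ} {β : ι → ℝ} {B : Set ℝ}

/-- A finite set of abscissae containing those of vertical tangents and of crossings. -/
structure IsCutting (f : ι → Polynomial ℝ) (β : ι → ℝ) (B : Set ℝ) : Prop where
  finite : B.Finite
  critical : ∀ i t, (curveFst (f i) (β i)).derivative.eval t = 0 →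
    (curveFst (f i) (β i)).eval t ∈ B
  crossing : ∀ i, ∀ t ∈ crossingSet f β i, (curveFst (f i) (β i)).eval t ∈ B

/-- Over each strip, the curves are the graphs of finitely many continuous functions, any two of
which agree or are disjoint. -/
theorem exists_sections (hdeg : ∀ i, 0 < (curveFst (f i) (β i)).degree) (hB : IsCutting f β B)
    {x₀ : ℝ} (hx₀ : x₀ ∉ B) :
    ∃ H : Set C(ℝ, ℝ), H.Finite ∧
      (∀ h ∈ H, ∀ x ∈ cutInterval B x₀, ∃ i, polyLevel (f i) (β i) (x, h x) = 0) ∧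
      (∀ i, ∀ p : ℝ × ℝ, p.1 ∈ cutInterval B x₀ \ B → polyLevel (f i) (β i) p = 0 →
        ∃ h ∈ H, h p.1 = p.2) ∧
      ∀ h ∈ H, ∀ h' ∈ H, ∀ x ∈ cutInterval B x₀ \ B, h x = h' x →
        ∀ y ∈ cutInterval B x₀ \ B, h y = h' y := by
  have hS := isStrip_cutInterval hB.finite hx₀
  set S := cutInterval B x₀ with hSdef
  have hbr : ∀ i t, (curveFst (f i) (β i)).eval t ∉ B → _ := fun i t ht =>
    exists_inverse_branch (hdeg i) hB.finite (hB.critical i) ht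
  choose! hinj himg ψ hψ using hbr
  -- One branch for each curve parameter over the base point `x₀`.
  set K : Set (ι × ℝ) := {a | (curveFst (f a.1) (β a.1)).eval a.2 = x₀} with hK
  have hKf : K.Finite := by
    have : K = ⋃ i, (fun t => (i, t)) '' {t | (curveFst (f i) (β i) - Polynomial.C x₀).IsRoot t} := by
      ext ⟨i, t⟩
      simp [hK, sub_eq_zero]
    rw [this]
    refine finite_iUnion fun i => (Polynomial.finite_setOfPred_isRoot fun h => ?_).image _
    have := hdeg i
    rw [sub_eq_zero.1 h] at this
    exact absurd Polynomial.degree_C_le (not_le.2 this)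
  set σ : ι × ℝ → C(ℝ, ℝ) := fun a =>
    ⟨fun x => (curveSnd (f a.1) (β a.1)).eval (ψ a.1 a.2 x), by fun_prop⟩ with hσ
  have hKB : ∀ a ∈ K, (curveFst (f a.1) (β a.1)).eval a.2 ∉ B := fun a ha => by
    rw [show (curveFst (f a.1) (β a.1)).eval a.2 = x₀ from ha]; exact hx₀
  have hψ' : ∀ a ∈ K, ∀ x ∈ S,
      ψ a.1 a.2 x ∈ cutInterval ((curveFst (f a.1) (β a.1)).eval ⁻¹' B) a.2 ∧
      polyCurve (f a.1) (β a.1) (ψ a.1 a.2 x) = (x, σ a x) := by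
    intro a ha x hx
    have h1 := himg a.1 a.2 (hKB a ha)
    rw [show (curveFst (f a.1) (β a.1)).eval a.2 = x₀ from ha] at h1
    obtain ⟨t, ht, rfl⟩ := h1.symm.subset hx
    have h2 : ψ a.1 a.2 ((curveFst (f a.1) (β a.1)).eval t) = t := hψ a.1 a.2 (hKB a ha) t ht
    rw [h2]
    refine ⟨ht, Prod.ext (eval_curveFst _ _ _).symm ?_⟩
    change _ = (curveSnd (f a.1) (β a.1)).eval (ψ a.1 a.2 _)
    rw [h2, eval_curveSnd]
  refine ⟨σ '' K, hKf.image _, ?_, ?_, ?_⟩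
  · rintro _ ⟨a, ha, rfl⟩ x hx
    exact ⟨a.1, by rw [← (hψ' a ha x hx).2, polyLevel_polyCurve]⟩
  · intro i p hp hp0
    set t := frameX (β i) p with ht
    have hpt : polyCurve (f i) (β i) t = p := polyCurve_frameX hp0
    have hxt : (curveFst (f i) (β i)).eval t = p.1 := by rw [eval_curveFst, hpt]
    have htB : (curveFst (f i) (β i)).eval t ∉ B := hxt ▸ hp.2
    have h1 := himg i t htB
    rw [hxt, cutInterval_eq hx₀ hp.1 hp.2] at h1
    obtain ⟨s, hs, hsx⟩ := h1.symm.subset (mem_cutInterval_self (P := B) (t₀ := x₀))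
    have hsK : (i, s) ∈ K := hsx
    have hsB : (curveFst (f i) (β i)).eval s ∉ B := hKB (i, s) hsK
    have hJ := cutInterval_eq (P := (curveFst (f i) (β i)).eval ⁻¹' B) htB hs hsB
    refine ⟨σ (i, s), ⟨_, hsK, rfl⟩, ?_⟩
    have h2 : ψ i s ((curveFst (f i) (β i)).eval t) = t :=
      hψ i s hsB t (hJ ▸ mem_cutInterval_self)
    change (curveSnd (f i) (β i)).eval (ψ i s p.1) = p.2
    rw [← hxt, h2, eval_curveSnd, hpt]
  · rintro _ ⟨a, ha, rfl⟩ _ ⟨b, hb, rfl⟩ x hx hxe y hy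
    have hcx := (hψ' a ha x hx.1).2
    have hcr : crossing (f a.1) (β a.1) (f b.1) (β b.1) = 0 := by
      by_contra hne
      refine hx.2 ?_
      have h1 : ψ a.1 a.2 x ∈ crossingSet f β a.1 := ⟨b.1, hne, by
        rw [eval_crossing, hcx, hxe, ← (hψ' b hb x hx.1).2, polyLevel_polyCurve]⟩
      have h2 := hB.crossing a.1 _ h1
      rwa [eval_curveFst, hcx] at h2
    -- A common value off `B` forces the curves to coincide. Then `τ` rewrites the first branch in
    -- the parameter of the second curve; agreeing with the second branch at `x`, it stays in the
    -- same interval of injectivity.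
    set τ : ℝ → ℝ := fun z => frameX (β b.1) (polyCurve (f a.1) (β a.1) (ψ a.1 a.2 z)) with hτ
    have hτc : Continuous τ := (continuous_frameX _).comp
      ((continuous_polyCurve _ _).comp (ψ a.1 a.2).continuous)
    have hτz : ∀ z ∈ S, polyCurve (f b.1) (β b.1) (τ z) = (z, σ a z) := fun z hz => by
      rw [← (hψ' a ha z hz).2]
      exact polyCurve_frameX (by rw [← eval_crossing, hcr, Polynomial.eval_zero])
    have hτx : τ x = ψ b.1 b.2 x := polyCurve_injective (f b.1) (β b.1) (by
      rw [hτz x hx.1, (hψ' b hb x hx.1).2, hxe])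
    have hτJ : τ '' (S \ B) ⊆ cutInterval ((curveFst (f b.1) (β b.1)).eval ⁻¹' B) b.2 := by
      refine subset_cutInterval
        (hS.ordConnected_diff.isPreconnected.image _ hτc.continuousOn) ?_ ⟨x, hx, rfl⟩
        (hτx ▸ (hψ' b hb x hx.1).1)
      rintro _ ⟨z, hz, rfl⟩ hzB
      refine hz.2 ?_
      have : (curveFst (f b.1) (β b.1)).eval (τ z) ∈ B := hzB
      rwa [eval_curveFst, hτz z hz.1] at this
    have hty : τ y = ψ b.1 b.2 y := by
      refine hinj b.1 b.2 (hKB b hb) (hτJ ⟨y, hy, rfl⟩) (hψ' b hb y hy.1).1 ?_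
      change Polynomial.eval _ _ = Polynomial.eval _ _
      rw [eval_curveFst, eval_curveFst, hτz y hy.1, (hψ' b hb y hy.1).2]
    have h1 := hτz y hy.1
    rw [hty, (hψ' b hb y hy.1).2] at h1
    exact (congrArg Prod.snd h1).symm

end Sections

/-- The value `none` stands for an absent bound and occurs when `H` is empty. -/
theorem exists_optional_max {H : Set C(ℝ, ℝ)} (hH : H.Finite) (x : ℝ) :
    ∃ o : Option C(ℝ, ℝ), (∀ g ∈ o, g ∈ H) ∧ ∀ h ∈ H, ∃ g ∈ o, h x ≤ g x := by
  rcases H.eq_empty_or_nonempty with rfl | hne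
  · exact ⟨none, by simp, by simp⟩
  · obtain ⟨g, hg, hmax⟩ := Set.exists_max_image H (fun h => h x) hH hne
    exact ⟨some g, by simpa using hg, fun h hh => ⟨g, rfl, hmax h hh⟩⟩

theorem exists_optional_min {H : Set C(ℝ, ℝ)} (hH : H.Finite) (x : ℝ) :
    ∃ o : Option C(ℝ, ℝ), (∀ g ∈ o, g ∈ H) ∧ ∀ h ∈ H, ∃ g ∈ o, g x ≤ h x := by
  rcases H.eq_empty_or_nonempty with rfl | hne
  · exact ⟨none, by simp, by simp⟩
  · obtain ⟨g, hg, hmin⟩ := Set.exists_min_image H (fun h => h x) hH hne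
    exact ⟨some g, by simpa using hg, fun h hh => ⟨g, rfl, hmin h hh⟩⟩

/-! ### Decomposition of the region into bands. -/

section Bands

variable {ι : Type*} {f : ι → Polynomial ℝ} {β : ι → ℝ} {B : Set ℝ}

/-- The upward ray of the rotated frame, reparametrized to unit horizontal speed; the sign of the
sine decides between right and left. -/
theorem exists_escape {p : ℝ × ℝ} {i : ι} (hsin : Real.sin (β i) ≠ 0)
    (hp : polyLevel (f i) (β i) p ≤ 0) : ∃ m : ℝ,
    (∀ t > 0, (p.1 + t, p.2 + m * t) ∉ closure (polyRegion f β)) ∨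
      ∀ t > 0, (p.1 - t, p.2 + m * t) ∉ closure (polyRegion f β) := by
  rcases lt_or_gt_of_ne hsin with h | h
  · refine ⟨-(Real.cos (β i) / Real.sin (β i)), Or.inl fun t ht => ?_⟩
    convert! not_mem_closure_polyRegion hp (t := -(t / Real.sin (β i)))
      (neg_pos.2 (div_neg_of_pos_of_neg ht h)) using 3
    · field_simp
      ring
    · ring
  · refine ⟨Real.cos (β i) / Real.sin (β i), Or.inr fun t ht => ?_⟩
    convert! not_mem_closure_polyRegion hp (t := t / Real.sin (β i)) (div_pos ht h) using 3
    · field_simp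
    · ring

variable [Finite ι]

/-- Over a strip, the region is a union of finitely many bands. -/
theorem exists_bands_over_strip (hsin : ∀ i, Real.sin (β i) ≠ 0)
    (hdeg : ∀ i, 0 < (curveFst (f i) (β i)).degree) (hB : IsCutting f β B)
    {x₀ : ℝ} (hx₀ : x₀ ∉ B) :
    ∃ 𝒟 : Set Band, 𝒟.Finite ∧ (∀ σ ∈ 𝒟, σ.base = cutInterval B x₀ ∧
        IsBand B (closure (polyRegion f β)) σ ∧ σ.inner B ⊆ polyRegion f β) ∧
      (∀ σ ∈ 𝒟, ∀ τ ∈ 𝒟, σ ≠ τ → σ.Below B τ ∨ τ.Below B σ) ∧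
      ∀ p ∈ polyRegion f β, p.1 ∈ cutInterval B x₀ \ B → ∃ σ ∈ 𝒟, p ∈ σ.inner B := by
  obtain ⟨H, hHf, hH1, hH2, hH3⟩ := exists_sections hdeg hB hx₀
  have hS := isStrip_cutInterval hB.finite hx₀
  set S := cutInterval B x₀ with hSdef
  have hx₀S : x₀ ∈ S \ B := ⟨mem_cutInterval_self, hx₀⟩
  have hlt : ∀ h ∈ H, ∀ h' ∈ H, ∀ x ∈ S \ B, h x < h' x → ∀ y ∈ S \ B, h y < h' y := by
    intro h hh h' hh' x hx hxlt y hy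
    by_contra! hle
    obtain ⟨z, hz, hz0⟩ := hS.ordConnected_diff.isPreconnected.intermediate_value hy hx
      (h'.continuous.sub h.continuous).continuousOn
      (show (0 : ℝ) ∈ Icc (h' y - h y) (h' x - h x) from ⟨by linarith, by linarith⟩)
    exact hxlt.ne (hH3 h hh h' hh' z hz (sub_eq_zero.1 hz0).symm x hx)
  have hle : ∀ h ∈ H, ∀ h' ∈ H, h x₀ ≤ h' x₀ → ∀ y ∈ S \ B, h y ≤ h' y := by
    intro h hh h' hh' hxle y hy
    rcases hxle.lt_or_eq with h1 | h1
    · exact (hlt h hh h' hh' x₀ hx₀S h1 y hy).le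
    · exact (hH3 h hh h' hh' x₀ hx₀S h1 y hy).le
  choose! lo hlo1 hlo2 using fun A (hA : A ⊆ H) => exists_optional_max (hHf.subset hA) x₀
  choose! up hup1 hup2 using fun A (hA : A ⊆ H) => exists_optional_min (hHf.subset hA) x₀
  -- A band is indexed by the set `A` of sections below it: it runs from the highest section in `A`
  -- to the lowest one outside `A`.
  set σ : Set C(ℝ, ℝ) → Band := fun A => ⟨S, lo A, up (H \ A)⟩ with hσ
  set 𝒜 : Set (Set C(ℝ, ℝ)) := {A | A ⊆ H ∧ (∀ h ∈ A, ∀ h' ∈ H \ A, h x₀ < h' x₀) ∧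
    ((σ A).inner B ∩ polyRegion f β).Nonempty} with h𝒜
  have hover : ∀ A ∈ 𝒜, (σ A).IsOver B := by
    rintro A ⟨hAH, hA, -⟩
    refine ⟨hS, fun g hg h hh x hx => ?_⟩
    have hg' := hlo1 A hAH g hg
    have hh' := hup1 (H \ A) sdiff_subset h hh
    exact hlt g (hAH hg') h hh'.1 x₀ hx₀S (hA g hg' h hh') x hx
  have hinner : ∀ A ∈ 𝒜, (σ A).inner B ⊆ polyRegion f β := by
    intro A hA p hp
    obtain ⟨hAH, -, q, hq, hqR⟩ := id hA
    refine mem_polyRegion.2 fun i => ?_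
    by_contra! hle0
    -- A change of sign would put a section strictly between two vertically consecutive ones.
    obtain ⟨r, hr, hr0⟩ := (hover A hA).isPreconnected_inner.intermediate_value hp hq
      (continuous_polyLevel (f i) (β i)).continuousOn ⟨hle0, (mem_polyRegion.1 hqR i).le⟩
    obtain ⟨h, hh, hhr⟩ := hH2 i r hr.1 hr0
    by_cases hhA : h ∈ A
    · obtain ⟨g, hg, hhg⟩ := hlo2 A hAH h hhA
      have h1 := hr.2.1 g hg
      have h2 := hle h hh g (hAH (hlo1 A hAH g hg)) hhg r.1 hr.1
      linarith
    · obtain ⟨g, hg, hhg⟩ := hup2 (H \ A) sdiff_subset h ⟨hh, hhA⟩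
      have h1 := hr.2.2 g hg
      have h2 := hle g (hup1 (H \ A) sdiff_subset g hg).1 h hh hhg r.1 hr.1
      linarith
  have hband : ∀ A ∈ 𝒜, IsBand B (closure (polyRegion f β)) (σ A) := by
    intro A hA
    refine ⟨hover A hA, (hover A hA).subset_closure_inner.trans (closure_mono (hinner A hA)),
      fun h hh c hc => ?_⟩
    obtain ⟨i, hi⟩ := hH1 h (hup1 (H \ A) sdiff_subset h hh).1 c hc.1
    exact exists_escape (hsin i) hi.le
  have hbelow : ∀ A ∈ 𝒜, ∀ A' ∈ 𝒜, ∀ h ∈ A', h ∉ A → (σ A).Below B (σ A') := by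
    intro A hA A' hA' h hhA' hhA
    have hhH := hA'.1 hhA'
    obtain ⟨k, hk, hkh⟩ := hup2 (H \ A) sdiff_subset h ⟨hhH, hhA⟩
    obtain ⟨g, hg, hhg⟩ := hlo2 A' hA'.1 h hhA'
    have hkH := (hup1 (H \ A) sdiff_subset k hk).1
    have hgH := hA'.1 (hlo1 A' hA'.1 g hg)
    have hne : k x₀ ≠ g x₀ := fun heq =>
      (hband A hA).not_adjacent (hband A' hA') rfl hk hg (hH3 k hkH g hgH x₀ hx₀S heq)
    exact ⟨rfl, k, hk, g, hg,
      hlt k hkH g hgH x₀ hx₀S (lt_of_le_of_ne (hkh.trans hhg) hne)⟩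
  refine ⟨σ '' 𝒜, (hHf.finite_subsets.subset fun A hA => hA.1).image _, ?_, ?_, ?_⟩
  · rintro _ ⟨A, hA, rfl⟩
    exact ⟨rfl, hband A hA, hinner A hA⟩
  · rintro _ ⟨A, hA, rfl⟩ _ ⟨A', hA', rfl⟩ hne
    by_cases hsub : A' ⊆ A
    · obtain ⟨h, hh, hh'⟩ := not_subset.1 fun hsub' : A ⊆ A' =>
        hne (congrArg σ (Subset.antisymm hsub' hsub))
      exact Or.inr (hbelow A' hA' A hA h hh hh')
    · obtain ⟨h, hh, hh'⟩ := not_subset.1 hsub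
      exact Or.inl (hbelow A hA A' hA' h hh hh')
  · intro p hp hpS
    have hpne : ∀ h ∈ H, h p.1 ≠ p.2 := fun h hh heq => by
      obtain ⟨i, hi⟩ := hH1 h hh p.1 hpS.1
      rw [heq] at hi
      exact (mem_polyRegion.1 hp i).ne' hi
    set A : Set C(ℝ, ℝ) := {h ∈ H | h p.1 < p.2} with hA
    have hAH : A ⊆ H := sep_subset _ _
    have hAc : ∀ h ∈ H \ A, p.2 < h p.1 := fun h hh =>
      lt_of_le_of_ne (not_lt.1 fun h' => hh.2 ⟨hh.1, h'⟩) (hpne h hh.1).symm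
    have hpin : p ∈ (σ A).inner B := ⟨hpS, fun g hg => (hlo1 A hAH g hg).2,
      fun h hh => hAc h (hup1 (H \ A) sdiff_subset h hh)⟩
    exact ⟨σ A, ⟨A, ⟨hAH, fun h hh h' hh' => hlt h hh.1 h' hh'.1 p.1 hpS
      (hh.2.trans (hAc h' hh')) x₀ hx₀S, p, hpin, hp⟩, rfl⟩, hpin⟩

theorem exists_bands (hsin : ∀ i, Real.sin (β i) ≠ 0)
    (hdeg : ∀ i, 0 < (curveFst (f i) (β i)).degree) (hB : IsCutting f β B) :
    ∃ 𝒟 : Set Band, 𝒟.Finite ∧ IsBandSystem B (closure (polyRegion f β)) 𝒟 ∧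
      (∀ σ ∈ 𝒟, σ.inner B ⊆ polyRegion f β) ∧
      ∀ p ∈ polyRegion f β, p.1 ∉ B → ∃ σ ∈ 𝒟, p ∈ σ.inner B := by
  have hstrip : ∀ S ∈ cutInterval B '' Bᶜ, ∃ 𝒟 : Set Band, 𝒟.Finite ∧ (∀ σ ∈ 𝒟, σ.base = S ∧
      IsBand B (closure (polyRegion f β)) σ ∧ σ.inner B ⊆ polyRegion f β) ∧
      (∀ σ ∈ 𝒟, ∀ τ ∈ 𝒟, σ ≠ τ → σ.Below B τ ∨ τ.Below B σ) ∧
      ∀ p ∈ polyRegion f β, p.1 ∈ S \ B → ∃ σ ∈ 𝒟, p ∈ σ.inner B := by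
    rintro _ ⟨x₀, hx₀, rfl⟩
    exact exists_bands_over_strip hsin hdeg hB hx₀
  choose! 𝒟 hf h1 h2 h3 using hstrip
  refine ⟨⋃ S ∈ cutInterval B '' Bᶜ, 𝒟 S,
    (finite_cutIntervals hB.finite).biUnion fun S hS => hf S hS, ⟨?_, ?_⟩, ?_, ?_⟩
  · intro σ hσ
    obtain ⟨S, hS, hσS⟩ := mem_iUnion₂.1 hσ
    exact (h1 S hS σ hσS).2.1
  · intro σ hσ τ hτ hne
    obtain ⟨S, hS, hσS⟩ := mem_iUnion₂.1 hσ
    obtain ⟨S', hS', hτS⟩ := mem_iUnion₂.1 hτ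
    by_cases hSS : S = S'
    · subst hSS
      exact Or.inr (h2 S hS σ hσS τ hτS hne)
    · refine Or.inl ?_
      rw [(h1 S hS σ hσS).1, (h1 S' hS' τ hτS).1]
      obtain ⟨x, hx, rfl⟩ := hS
      obtain ⟨y, hy, rfl⟩ := hS'
      exact ⟨fun z hz hz' => hSS ((cutInterval_eq hx hz.1 hz.2).symm.trans
        (cutInterval_eq hy hz' hz.2)), fun z hz hz' => hSS ((cutInterval_eq hx hz' hz.2).symm.trans
        (cutInterval_eq hy hz.1 hz.2))⟩
  · intro σ hσ
    obtain ⟨S, hS, hσS⟩ := mem_iUnion₂.1 hσ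
    exact (h1 S hS σ hσS).2.2
  · intro p hp hpB
    have hS : cutInterval B p.1 ∈ cutInterval B '' Bᶜ := ⟨p.1, hpB, rfl⟩
    obtain ⟨σ, hσ, hpσ⟩ := h3 _ hS p hp ⟨mem_cutInterval_self, hpB⟩
    exact ⟨σ, mem_iUnion₂.2 ⟨_, hS, hσ⟩, hpσ⟩

theorem exists_isCutting (hdeg : ∀ i, 0 < (curveFst (f i) (β i)).degree) :
    ∃ B, IsCutting f β B := by
  refine ⟨⋃ i, (curveFst (f i) (β i)).eval ''
    ({t | (curveFst (f i) (β i)).derivative.IsRoot t} ∪ crossingSet f β i),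
    ⟨finite_iUnion fun i => ((Polynomial.finite_setOfPred_isRoot fun h => ?_).union
      (finite_crossingSet i)).image _, fun i t ht => mem_iUnion.2 ⟨i, t, Or.inl ht, rfl⟩,
      fun i t ht => mem_iUnion.2 ⟨i, t, Or.inr ht, rfl⟩⟩⟩
  exact (Polynomial.natDegree_pos_iff_degree_pos.2 (hdeg i)).ne'
    (Polynomial.derivative_eq_zero.1 h)

/-- The conclusion for curves in general position with respect to the vertical direction. -/
theorem exists_typeII_of_generic (hsin : ∀ i, Real.sin (β i) ≠ 0)
    (hdeg : ∀ i, 0 < (curveFst (f i) (β i)).degree) :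
    ∃ 𝒰 : Set (Set (ℝ × ℝ)), 𝒰.Finite ∧ (∀ U ∈ 𝒰, IsTypeII U) ∧
      (∀ U ∈ 𝒰, ∀ V ∈ 𝒰, U ≠ V → Disjoint U V) ∧ polyRegion f β = ⋃₀ 𝒰 := by
  obtain ⟨B, hB⟩ := exists_isCutting hdeg
  obtain ⟨𝒟, h𝒟f, h𝒟, hinner, hcover⟩ := exists_bands hsin hdeg hB
  set R := polyRegion f β with hR
  have hRo : IsOpen R := isOpen_polyRegion
  have hdense : Dense {p : ℝ × ℝ | p.1 ∉ B} :=
    (hB.finite.countable.dense_compl ℝ).preimage isOpenMap_fst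
  have hmeet : ∀ x, ∀ p ∈ connectedComponentIn R x, p.1 ∉ B → ∃ σ ∈ 𝒟, p ∈ σ.inner B ∧
      σ.inner B ⊆ connectedComponentIn R x := by
    intro x p hp hpB
    obtain ⟨σ, hσ, hpσ⟩ := hcover p (connectedComponentIn_subset R x hp) hpB
    exact ⟨σ, hσ, hpσ, subset_connectedComponentIn_of_meets
      (h𝒟.isBand σ hσ).isPreconnected_inner (hinner σ hσ) ⟨p, hpσ, hp⟩⟩
  refine ⟨connectedComponentIn R '' R, ?_, ?_, ?_, ?_⟩
  -- Every component contains the interior of some band, so there are finitely many.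
  · choose! q hq using fun σ hσ => (h𝒟.isBand σ hσ).inner_nonempty
    refine (h𝒟f.image fun σ => connectedComponentIn R (q σ)).subset ?_
    rintro _ ⟨x, hx, rfl⟩
    obtain ⟨p, hp, hpB⟩ := hdense.inter_open_nonempty _ hRo.connectedComponentIn
      ⟨x, mem_connectedComponentIn hx⟩
    obtain ⟨σ, hσ, -, hσC⟩ := hmeet x p hp hpB
    exact ⟨σ, hσ, (connectedComponentIn_eq (hσC (hq σ hσ))).symm⟩
  · rintro _ ⟨x, hx, rfl⟩
    set C := connectedComponentIn R x with hC
    have hCo : IsOpen C := hRo.connectedComponentIn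
    have hCconn : IsConnected C := isConnected_connectedComponentIn_iff.2 hx
    have hint : interior (closure C) = C :=
      interior_closure_connectedComponentIn hRo interior_closure_polyRegion.subset
    refine ⟨closure C, ⟨⟨C, hCo, hCconn, rfl⟩, ?_, frontier_component_eq_sUnion f β x⟩, ?_⟩
    · have hfin : {σ ∈ 𝒟 | σ.inner B ⊆ C}.Finite := h𝒟f.subset (sep_subset _ _)
      have hsys : IsBandSystem B (closure R) (hfin.toFinset : Set Band) := by
        rw [hfin.coe_toFinset]
        exact h𝒟.mono (sep_subset _ _)
      have hseg : IsSegmentSystem B (closure R) ((∅ : Finset (ℝ × Set ℝ)) : Set (ℝ × Set ℝ)) := by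
        simp [IsSegmentSystem]
      have hcl := isClosed_bandUnion hsys hseg (Finset.finite_toSet _) (Finset.finite_toSet _)
      have hT : closure C =
          bandUnion (hfin.toFinset : Set Band) ((∅ : Finset (ℝ × Set ℝ)) : Set (ℝ × Set ℝ)) := by
        refine Subset.antisymm ?_ ?_
        · refine closure_minimal ((hdense.open_subset_closure_inter hCo).trans
            (closure_minimal ?_ ?_)) ?_
          · rintro p ⟨hp, hpB⟩
            obtain ⟨σ, hσ, hpσ, hσC⟩ := hmeet x p hp hpB
            refine mem_bandUnion.2 (Or.inl ⟨σ, by simpa using ⟨hσ, hσC⟩, hpσ.1.1,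
              fun g hg => (hpσ.2.1 g hg).le, fun h hh => (hpσ.2.2 h hh).le⟩)
          all_goals exact hcl
        · intro p hp
          rcases mem_bandUnion.1 hp with ⟨σ, hσ, hpσ⟩ | ⟨v, hv, -⟩
          · rw [hfin.coe_toFinset] at hσ
            exact closure_mono hσ.2 ((h𝒟.isBand σ hσ.1).subset_closure_inner hpσ)
          · simp at hv
      have hext := isExtensor_bandUnion _ _ hsys hseg (hT ▸ hCconn.closure)
      rw [← hT] at hext
      exact hext.isSimplyConnected isClosed_closure hCconn.nonempty.closure
    · rw [self_sdiff_frontier, hint]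
  · rintro _ ⟨x, hx, rfl⟩ _ ⟨y, hy, rfl⟩ hne
    rw [Set.disjoint_left]
    intro z hzx hzy
    exact hne ((connectedComponentIn_eq hzx).trans (connectedComponentIn_eq hzy).symm)
  · refine Subset.antisymm (fun x hx => ⟨_, ⟨x, hx, rfl⟩, mem_connectedComponentIn hx⟩) ?_
    rintro x ⟨_, ⟨y, hy, rfl⟩, hxy⟩
    exact connectedComponentIn_subset R y hxy

end Bands

/-! ### Rotation into general position and conclusion. -/

/-- Rotation of the plane. -/
noncomputable def planeRotation (α : ℝ) : (ℝ × ℝ) ≃ₜ (ℝ × ℝ) where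
  toFun p := framePoint α p.1 p.2
  invFun p := (frameX α p, frameY α p)
  left_inv p := Prod.ext (frameX_framePoint α p.1 p.2) (frameY_framePoint α p.1 p.2)
  right_inv p := framePoint_frame α p
  continuous_toFun := continuous_framePoint α
  continuous_invFun := (continuous_frameX α).prodMk (continuous_frameY α)

theorem frameX_planeRotation (α θ : ℝ) (p : ℝ × ℝ) :
    frameX θ (planeRotation α p) = frameX (θ - α) p := by
  change frameX θ (framePoint α p.1 p.2) = _
  simp only [frameX, framePoint, Real.cos_sub, Real.sin_sub]
  ring

theorem frameY_planeRotation (α θ : ℝ) (p : ℝ × ℝ) :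
    frameY θ (planeRotation α p) = frameY (θ - α) p := by
  change frameY θ (framePoint α p.1 p.2) = _
  simp only [frameY, framePoint, Real.cos_sub, Real.sin_sub]
  ring

theorem IsSide.preimage_planeRotation {S : Set (ℝ × ℝ)} (hS : IsSide S) (α : ℝ) :
    IsSide (planeRotation α ⁻¹' S) := by
  obtain ⟨f, θ, J, h1, h2, h3, rfl⟩ := hS
  refine ⟨f, θ - α, J, h1, h2, h3, ?_⟩
  ext p
  change frameX θ (planeRotation α p) ∈ J ∧
    frameY θ (planeRotation α p) = f.eval (frameX θ (planeRotation α p)) ↔ _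
  rw [frameX_planeRotation, frameY_planeRotation]
  rfl

theorem IsTypeII.preimage_planeRotation {U : Set (ℝ × ℝ)} (hU : IsTypeII U) (α : ℝ) :
    IsTypeII (planeRotation α ⁻¹' U) := by
  obtain ⟨T, ⟨⟨D, hDo, hDc, rfl⟩, hT, 𝒮, h𝒮f, h𝒮, hfr⟩, rfl⟩ := hU
  have hfr' := (planeRotation α).preimage_frontier (closure D)
  refine ⟨planeRotation α ⁻¹' closure D, ⟨⟨planeRotation α ⁻¹' D,
    hDo.preimage (planeRotation α).continuous, ?_, (planeRotation α).preimage_closure D⟩, ?_,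
    (fun S => planeRotation α ⁻¹' S) '' 𝒮, h𝒮f.image _, ?_, ?_⟩, ?_⟩
  · exact (planeRotation α).isConnected_preimage.2 hDc
  · exact (planeRotation α).isSimplyConnected_preimage.2 hT
  · rintro _ ⟨S, hS, rfl⟩
    exact (h𝒮 S hS).preimage_planeRotation α
  · rw [← hfr', hfr, sUnion_image, preimage_sUnion]
  · rw [← hfr', preimage_sdiff]

theorem preimage_polyRegion {ι : Type*} (f : ι → Polynomial ℝ) (β : ι → ℝ) (α : ℝ) :
    planeRotation α ⁻¹' polyRegion f (fun i => β i + α) = polyRegion f β := by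
  ext p
  rw [mem_preimage, mem_polyRegion, mem_polyRegion]
  refine forall_congr' fun i => ?_
  rw [polyLevel, polyLevel, frameX_planeRotation, frameY_planeRotation, add_sub_cancel_right]

/-- A rotation bringing a finite family of graphs into general position. -/
theorem exists_generic_angle {ι : Type*} [Finite ι] (f : ι → Polynomial ℝ) (β : ι → ℝ) :
    ∃ α : ℝ, ∀ i, Real.sin (β i + α) ≠ 0 ∧ 0 < (curveFst (f i) (β i + α)).degree := by
  -- Two zeros of `g` differ by a multiple of π, so a half-open interval of length π contains at
  -- most one.
  have key : ∀ g : ℝ → ℝ, (∀ a b, g a = 0 → g b = 0 → Real.sin (a - b) = 0) → ∀ θ : ℝ,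
      {α ∈ Ico 0 Real.pi | g (θ + α) = 0}.Finite := by
    intro g hg θ
    refine Set.Subsingleton.finite ?_
    rintro a ⟨ha, ha0⟩ b ⟨hb, hb0⟩
    have h := hg _ _ ha0 hb0
    rw [add_sub_add_left_eq_sub] at h
    exact sub_eq_zero.1 ((Real.sin_eq_zero_iff_of_lt_of_lt (by linarith [ha.1, hb.2])
      (by linarith [ha.2, hb.1])).1 h)
  have hfin : (⋃ i, ({α ∈ Ico 0 Real.pi | Real.sin (β i + α) = 0} ∪
      {α ∈ Ico 0 Real.pi | (fun θ => Real.cos θ - Real.sin θ * (f i).coeff 1) (β i + α) = 0})).Finite := by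
    refine finite_iUnion fun i => (key Real.sin (fun a b ha hb => ?_) _).union
      (key (fun θ => Real.cos θ - Real.sin θ * (f i).coeff 1) (fun a b ha hb => ?_) _)
    · rw [Real.sin_sub, ha, hb]; ring
    · rw [Real.sin_sub]
      linear_combination Real.sin a * hb - Real.sin b * ha
  obtain ⟨α, hα, hα'⟩ := ((Ico_infinite Real.pi_pos).sdiff hfin).nonempty
  refine ⟨α, fun i => ⟨fun h => hα' (mem_iUnion.2 ⟨i, Or.inl ⟨hα, h⟩⟩), ?_⟩⟩
  -- The linear coefficient of the first coordinate is the second function whose zeros were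
  -- excluded; its nonvanishing forces positive degree.
  have hc : (curveFst (f i) (β i + α)).coeff 1 ≠ 0 := fun h =>
    hα' (mem_iUnion.2 ⟨i, Or.inr ⟨hα, by simpa [curveFst] using h⟩⟩)
  exact Polynomial.natDegree_pos_iff_degree_pos.1 (Polynomial.le_natDegree_of_ne_zero hc)

theorem theorem4p3 (k : ℕ) (f : Fin k → Polynomial ℝ) (β : Fin k → ℝ) :
    ∃ (m : ℕ) (U : Fin m → Set (ℝ × ℝ)),
      (∀ j, IsTypeII (U j)) ∧
      Pairwise (fun i j => Disjoint (U i) (U j)) ∧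
      (⋂ i, openPolyHalfPlane (f i) (β i)) = ⋃ j, U j := by
  obtain ⟨α, hα⟩ := exists_generic_angle f β
  obtain ⟨𝒰, hf, hII, hdisj, hU⟩ := exists_typeII_of_generic (f := f)
    (fun i => (hα i).1) (fun i => (hα i).2)
  have := hf.to_subtype
  obtain ⟨m, ⟨e⟩⟩ := Finite.exists_equiv_fin 𝒰
  refine ⟨m, fun j => planeRotation α ⁻¹' (e.symm j : Set (ℝ × ℝ)),
    fun j => (hII _ (e.symm j).2).preimage_planeRotation α, fun i j hij => ?_, ?_⟩
  · exact (hdisj _ (e.symm i).2 _ (e.symm j).2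
      fun h => hij (e.symm.injective (Subtype.ext h))).preimage _
  · change polyRegion f β = _
    rw [← preimage_polyRegion f β α, hU, ← preimage_iUnion]
    congr 1
    rw [sUnion_eq_iUnion]
    exact (e.symm.surjective.iUnion_comp fun U : 𝒰 => (U : Set (ℝ × ℝ))).symm
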